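/- Let $0<\delta_1<\delta_2$ be real numbers, let $N,M\ge 0$ be integers, and let $\Omega_1,\dots,\Omega_N$, $P_{N+1},\dots,P_{N+M}$ and $C_1,\dots,C_{N+M}$ be arbitrary real numbers. Put $$K_i=\tfrac12\bigl(|\Omega_i-\delta_1|-|\Omega_i+\delta_1|\bigr)\ (i\le N),\qquad Q_i=\max(0,P_i-\delta_2)+\min(0,P_i+\delta_2)\ (i>N),$$ $$\Phi_i(m,n)=\begin{cases}\Omega_i m+K_i n+C_i & (1\le i\le N),\\ Q_i m+P_i n+C_i & (N<i\le N+M),\end{cases}$$ and for $1\le i<j\le N+M$ $$B_{ij}=\begin{cases}2\max(\min(\Omega_i,-\Omega_j),\min(-\Omega_i,\Omega_j)) & (i<j\le N),\\ \max(\min(-2P_i-Q_i,2P_j+Q_j),\min(2P_i+Q_i,-2P_j-Q_j)) & (N<i<j),\\ B'_{ij} & (i\le N<j),\end{cases}$$ $$B'_{ij}=\begin{cases}-\max(\min(\Omega_i+2K_i,2Q_j),\min(\Omega_i+2K_i-P_j+\delta_2,0)) & (\Omega_i>0,\ P_j>0),\\ \max(\min(\Omega_i+2K_i,-2Q_j),\min(\Omega_i+2K_i+P_j+\delta_2,0))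 & (\Omega_i>0,\ P_j<0),\\ \max(\min(-\Omega_i-2K_i,2Q_j),\min(-\Omega_i-2K_i-P_j+\delta_2,0)) & (\Omega_i<0,\ P_j>0),\\ -\max(\min(-\Omega_i-2K_i,-2Q_j),\min(-\Omega_i-2K_i+P_j+\delta_2,0)) & (\Omega_i<0,\ P_j<0),\\ 0 & (\Omega_i=0\text{ or }P_j=0).\end{cases}$$ For $m,n\in\mathbb Z$ let $$F^m_n=\max_{I\subseteq\{1,\dots,N+M\}}\Bigl(\sum_{i\in I}\Phi_i(m,n)+\sum_{i,j\in I,\ i<j}B_{ij}\Bigr),$$ where $I=\emptyset$ contributes $0$. Then for all $m,n\in\mathbb Z$ $$F_{n+1}^{m+1}+F_{n}^{m-1}=\max\bigl(F_{n+1}^{m}+F_{n}^{m},\ F_{n}^{m+1}+F_{n+1}^{m-1}-\delta_1,\ F_{n+2}^{m}+F_{n-1}^{m}-\delta_2\bigr).$$ Moreover, let $$U^m_n=F^m_{n+1}+F^{m+1}_n-F^m_n-F^{m+1}_{n+1},\quad V^m_n=F^{m+1}_n+F^{m-1}_n-2F^m_n,\quad X^m_n=F^m_{n+1}+F^m_{n-1}-2F^m_n.$$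 If $M=0$, then for all $m,n\in\mathbb Z$: $-\delta_2+X^m_n+X^m_{n+1}<0$; $U^m_k,V^m_k,X^m_k\to0$ as $k\to-\infty$; and $U$ evolves by the Box-Ball system with box capacity $\delta_1$ and carrier $V$, that is, $0\le U^m_n\le\delta_1$, for each $m$ only finitely many $U^m_k$ are nonzero, and $$V^m_n=\sum_{k=-\infty}^{n}\bigl(U^{m-1}_{k-1}-U^m_{k-1}\bigr),\qquad U^m_n=\min\Bigl(\sum_{k=-\infty}^{n}\bigl(U^{m-1}_{k-1}-U^m_{k-1}\bigr),\ \delta_1-U^{m-1}_n\Bigr).$$ -/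

import Mathlib

noncomputable section

namespace MixedSoliton

/-- The ultradiscrete equation
`F^{m+1}_{n+1} + F^{m-1}_n
  = max (F^m_{n+1} + F^m_n, F^{m+1}_n + F^{m-1}_{n+1} - δ₁, F^m_{n+2} + F^m_{n-1} - δ₂)`
for all integers `m`, `n`; here `F m n` stands for `F^m_n`. -/
def SolvesEBB (δ₁ δ₂ : ℝ) (F : ℤ → ℤ → ℝ) : Prop :=
  ∀ m n : ℤ,
    F (m + 1) (n + 1) + F (m - 1) n =
      max (F m (n + 1) + F m n)
        (max (F (m + 1) n + F (m - 1) (n + 1) - δ₁)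
          (F m (n + 2) + F m (n - 1) - δ₂))

/-- KdV-type dispersion: `K = (|Ω - δ₁| - |Ω + δ₁|) / 2`. -/
def dispK (δ₁ Ω : ℝ) : ℝ := (|Ω - δ₁| - |Ω + δ₁|) / 2

/-- Toda-type dispersion: `Q = max (0, P - δ₂) + min (0, P + δ₂)`. -/
def dispQ (δ₂ P : ℝ) : ℝ := max 0 (P - δ₂) + min 0 (P + δ₂)

/-- Interaction of two KdV-type solitons. -/
def interKdV (Ω Ω' : ℝ) : ℝ := 2 * max (min Ω (-Ω')) (min (-Ω) Ω')

/-- Interaction of two Toda-type solitons. -/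
def interToda (δ₂ P P' : ℝ) : ℝ :=
  max (min (-2 * P - dispQ δ₂ P) (2 * P' + dispQ δ₂ P'))
    (min (2 * P + dispQ δ₂ P) (-2 * P' - dispQ δ₂ P'))

/-- Interaction of a KdV-type soliton with a Toda-type soliton.  If `Ω = 0` or `P = 0` the value
is `0`, which is the common limit of the four formulas there. -/
def interMixed (δ₁ δ₂ Ω P : ℝ) : ℝ :=
  if 0 < Ω ∧ 0 < P then
    -max (min (Ω + 2 * dispK δ₁ Ω) (2 * dispQ δ₂ P)) (min (Ω + 2 * dispK δ₁ Ω - P + δ₂) 0)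
  else if 0 < Ω ∧ P < 0 then
    max (min (Ω + 2 * dispK δ₁ Ω) (-2 * dispQ δ₂ P)) (min (Ω + 2 * dispK δ₁ Ω + P + δ₂) 0)
  else if Ω < 0 ∧ 0 < P then
    max (min (-Ω - 2 * dispK δ₁ Ω) (2 * dispQ δ₂ P)) (min (-Ω - 2 * dispK δ₁ Ω - P + δ₂) 0)
  else if Ω < 0 ∧ P < 0 then
    -max (min (-Ω - 2 * dispK δ₁ Ω) (-2 * dispQ δ₂ P)) (min (-Ω - 2 * dispK δ₁ Ω + P + δ₂) 0)
  else 0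

/-- The phase `Φ_i(m, n)`: the first `N` indices are of KdV type, the last `M` of Toda type. -/
def phase (δ₁ δ₂ : ℝ) {N M : ℕ} (Ω : Fin N → ℝ) (P : Fin M → ℝ) (C : Fin (N + M) → ℝ)
    (i : Fin (N + M)) (m n : ℤ) : ℝ :=
  Fin.addCases (motive := fun _ => ℝ)
    (fun a => Ω a * m + dispK δ₁ (Ω a) * n)
    (fun b => dispQ δ₂ (P b) * m + P b * n) i + C i

/-- The interaction factor `B_ij`.  It is used only for `i < j`, so the case of `i` of
Toda type and `j` of KdV type never enters. -/
def inter (δ₁ δ₂ : ℝ) {N M : ℕ} (Ω : Fin N → ℝ) (P : Fin M → ℝ) (i j : Fin (N + M)) : ℝ :=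
  Fin.addCases (motive := fun _ => ℝ)
    (fun a => Fin.addCases (motive := fun _ => ℝ)
      (fun a' => interKdV (Ω a) (Ω a'))
      (fun b' => interMixed δ₁ δ₂ (Ω a) (P b')) j)
    (fun b => Fin.addCases (motive := fun _ => ℝ)
      (fun a' => interMixed δ₁ δ₂ (Ω a') (P b))
      (fun b' => interToda δ₂ (P b) (P b')) j) i

/-- The function `F^m_n`, a maximum over all subsets `I` of the `N + M` indices (the empty
subset contributes `0`). -/
def mixedSoliton (δ₁ δ₂ : ℝ) {N M : ℕ} (Ω : Fin N → ℝ) (P : Fin M → ℝ) (C : Fin (N + M) → ℝ)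
    (m n : ℤ) : ℝ :=
  (Finset.univ : Finset (Finset (Fin (N + M)))).sup' Finset.univ_nonempty fun I =>
    ∑ i ∈ I, phase δ₁ δ₂ Ω P C i m n +
      ∑ i ∈ I, ∑ j ∈ I with i < j, inter δ₁ δ₂ Ω P i j

/-- `U^m_n = F^m_{n+1} + F^{m+1}_n - F^m_n - F^{m+1}_{n+1}`. -/
def fieldU (F : ℤ → ℤ → ℝ) (m n : ℤ) : ℝ :=
  F m (n + 1) + F (m + 1) n - F m n - F (m + 1) (n + 1)

/-- `V^m_n = F^{m+1}_n + F^{m-1}_n - 2 F^m_n`. -/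
def fieldV (F : ℤ → ℤ → ℝ) (m n : ℤ) : ℝ :=
  F (m + 1) n + F (m - 1) n - 2 * F m n

/-- `X^m_n = F^m_{n+1} + F^m_{n-1} - 2 F^m_n`. -/
def fieldX (F : ℤ → ℤ → ℝ) (m n : ℤ) : ℝ :=
  F m (n + 1) + F m (n - 1) - 2 * F m n

/-- A state of the Box-Ball system with box capacity `δ`: the content of each box is between `0`
and `δ`, and all but finitely many boxes are empty. -/
structure IsBoxBallState (δ : ℝ) (u : ℤ → ℝ) : Prop where
  nonneg : ∀ n, 0 ≤ u n
  le_capacity : ∀ n, u n ≤ δ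
  finite_support : (Function.support u).Finite

/-- The carrier load `∑_{k ≤ n} (u_{k-1} - u'_{k-1})` on arrival at box `n`, when the state `u`
is being changed to the state `u'`. -/
def carrierLoad (u u' : ℤ → ℝ) (n : ℤ) : ℝ :=
  ∑ᶠ (k : ℤ) (_ : k ≤ n), (u (k - 1) - u' (k - 1))

/-- `U` is an orbit of the Box-Ball system with box capacity `δ`: each `U m` is a state and
`U^m_n = min (∑_{k ≤ n} (U^{m-1}_{k-1} - U^m_{k-1}), δ - U^{m-1}_n)`. -/
structure IsBoxBallEvolution (δ : ℝ) (U : ℤ → ℤ → ℝ) : Prop where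
  state : ∀ m, IsBoxBallState δ (U m)
  step : ∀ m n, U m n = min (carrierLoad (U (m - 1)) (U m) n) (δ - U (m - 1) n)

end MixedSoliton

end

/-! Write a sum of two values of F as a maximum over pairs of subsets (I, J). With ε = χ_I + χ_J and
τ = χ_I − χ_J, four times the value splits into a term depending only on ε and on the sum of the two
lattice points, and an Ising energy of τ in a field determined by their difference (a, b). The four
pairs of points in the equation have the same sum. So one may keep ε, flip signs of τ, and compare
energies in the directions (2,1), (0,1), (2,−1), (0,3), up to the constants 4δ₁ and 4δ₂. Absorbing
the signs of the parameters into τ makes all parameters nonnegative.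

The energy is then a layer-cake integral over a height u (`hasInt_density`). At each u the integrand
depends on six integers, the spin sums over upper level sets of the parameters, and it is a linear
form minus a sum of squares. Assigning signs in decreasing order of the parameter makes these sums
follow any prescribed ±1 path (`exists_spin_of_path`), so one configuration can be tuned in all
layers at once; only the parity of each sum is forced.

The path 0, 1, 0, 1, … is optimal for (2,1) in every layer and dominates the other three directions
(`exists_layerEnergy_two_one_ge`). Conversely, direction (0,1) reaches this optimum if no layer is
bad; otherwise the highest bad layer tells where to switch to a reflected path, and (2,−1) or (0,3)
reaches it (`exists_layerEnergy_two_one_le`).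

For M = 0 the same comparison gives 0 ≤ U ≤ δ₁ and makes the δ₂ term of the maximum redundant. For
each m, F is affine for n near ±∞ with coefficients independent of m, so the fields vanish there and
V is a telescoping sum of differences of U. -/

noncomputable section

namespace MixedSoliton

/-! ### Pairs of subsets as spin configurations -/

section Pairs

variable {ι : Type*} [Fintype ι]

/-- The energy of a spin configuration `τ` in the field `l` with couplings `B`. -/
def spinEnergy (l : ι → ℝ) (B : ι → ι → ℝ) (τ : ι → ℤ) : ℝ :=
  2 * ∑ i, (τ i : ℝ) * l i + ∑ i, ∑ j, (τ i : ℝ) * τ j * B i j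

/-- A gauge transformation: signs common to fields and couplings move into the spins. This is what
reduces everything to nonnegative parameters. -/
theorem spinEnergy_sign (l l₀ : ι → ℝ) (B G : ι → ι → ℝ) (s τ : ι → ℤ)
    (hl : ∀ i, l i = s i * l₀ i) (hB : ∀ i j, B i j = s i * s j * G i j) :
    spinEnergy l B τ = spinEnergy l₀ G (fun i => s i * τ i) := by
  simp only [spinEnergy, hl, hB]
  congr 1
  · congr 1
    exact Finset.sum_congr rfl fun i _ => by push_cast; ring
  · exact Finset.sum_congr rfl fun i _ => Finset.sum_congr rfl fun j _ => by push_cast; ring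

variable [LinearOrder ι]

/-- The value of a subset `I` for phases `φ` and interactions `B`. -/
def weight (φ : ι → ℝ) (B : ι → ι → ℝ) (I : Finset ι) : ℝ :=
  ∑ i ∈ I, φ i + ∑ i ∈ I, ∑ j ∈ I with i < j, B i j

/-- The maximum of `weight` over all subsets. -/
def maxWeight (φ : ι → ℝ) (B : ι → ι → ℝ) : ℝ :=
  (Finset.univ : Finset (Finset ι)).sup' Finset.univ_nonempty (weight φ B)

theorem weight_le_maxWeight (φ : ι → ℝ) (B : ι → ι → ℝ) (I : Finset ι) :
    weight φ B I ≤ maxWeight φ B :=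
  Finset.le_sup' (weight φ B) (Finset.mem_univ I)

theorem exists_maxWeight_eq (φ : ι → ℝ) (B : ι → ι → ℝ) : ∃ I, maxWeight φ B = weight φ B I := by
  obtain ⟨I, -, h⟩ := Finset.exists_mem_eq_sup' (Finset.univ_nonempty) (weight φ B)
  exact ⟨I, h⟩

/-- The `0/1` indicator of a subset. -/
def chi (I : Finset ι) (i : ι) : ℤ := if i ∈ I then 1 else 0

/-- The symmetric double sum counts each pair twice and also the diagonal, which `weight` omits;
since χ² = χ, the diagonal is cancelled by shifting the linear term. -/
theorem weight_eq_chi (φ : ι → ℝ) (B : ι → ι → ℝ) (hB : ∀ i j, B i j = B j i) (I : Finset ι) :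
    weight φ B I = ∑ i, (chi I i : ℝ) * (φ i - B i i / 2) +
      (∑ i, ∑ j, (chi I i : ℝ) * chi I j * B i j) / 2 := by
  have h1 : ∀ f : ι → ℝ, ∑ i, (chi I i : ℝ) * f i = ∑ i ∈ I, f i := by
    intro f
    simp [chi, ite_mul, Finset.sum_ite_mem]
  have h2 : ∑ i, ∑ j, (chi I i : ℝ) * chi I j * B i j = ∑ i ∈ I, ∑ j ∈ I, B i j := by
    rw [← h1]
    refine Finset.sum_congr rfl fun i _ => ?_
    rw [← h1, Finset.mul_sum]
    exact Finset.sum_congr rfl fun j _ => by ring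
  have h3 : ∀ i ∈ I, ∑ j ∈ I, B i j =
      ∑ j ∈ I with i < j, B i j + ∑ j ∈ I with j < i, B i j + B i i := by
    intro i hi
    rw [Finset.sum_filter, Finset.sum_filter, ← Finset.sum_add_distrib]
    have : B i i = ∑ j ∈ I, if j = i then B i j else 0 := by simp [hi]
    rw [this, ← Finset.sum_add_distrib]
    refine Finset.sum_congr rfl fun j _ => ?_
    rcases lt_trichotomy i j with h | h | h
    · simp [h, h.not_gt, h.ne']
    · simp [h]
    · simp [h, h.not_gt, h.ne]
  have h4 : ∑ i ∈ I, ∑ j ∈ I with j < i, B i j = ∑ i ∈ I, ∑ j ∈ I with i < j, B i j := by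
    simp only [Finset.sum_filter]
    rw [Finset.sum_comm]
    exact Finset.sum_congr rfl fun i _ => Finset.sum_congr rfl fun j _ => by rw [hB]
  rw [h1, h2, Finset.sum_congr rfl h3, Finset.sum_add_distrib, Finset.sum_add_distrib, h4,
    Finset.sum_sub_distrib, ← Finset.sum_div, weight]
  ring

/-- Polarisation: 2(χφ + χ'ψ) = (χ + χ')(φ + ψ) + (χ − χ')(φ − ψ), and likewise for the quadratic
terms. The bracket sees I and J only through χ_I + χ_J. -/
theorem weight_add_weight (φ ψ : ι → ℝ) (B : ι → ι → ℝ) (hB : ∀ i j, B i j = B j i)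
    (I J : Finset ι) :
    4 * (weight φ B I + weight ψ B J) =
      (2 * ∑ i, ((chi I i + chi J i : ℤ) : ℝ) * (φ i + ψ i - B i i) +
        ∑ i, ∑ j, ((chi I i + chi J i : ℤ) : ℝ) * (chi I j + chi J j : ℤ) * B i j) +
      spinEnergy (fun i => φ i - ψ i) B (fun i => chi I i - chi J i) := by
  rw [weight_eq_chi φ B hB, weight_eq_chi ψ B hB, spinEnergy]
  simp only [Finset.mul_sum, mul_add, mul_div_assoc', Finset.sum_div, ← Finset.sum_add_distrib]
  refine Finset.sum_congr rfl fun i _ => ?_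
  have : ∀ a b d e : ℝ, ∀ s t r q : ι → ℝ, a + b = d + e →
      (∀ j, s j + t j = r j + q j) → a + ∑ j, s j + (b + ∑ j, t j) =
        d + ∑ j, r j + (e + ∑ j, q j) := by
    intro a b d e s t r q h1 h2
    have := Finset.sum_congr (s₁ := Finset.univ) rfl fun j _ => h2 j
    simp only [Finset.sum_add_distrib] at this
    linarith
  refine this _ _ _ _ _ _ _ _ ?_ ?_
  · push_cast; ring
  · intro j; push_cast; ring

/-- Flipping the sign of a spin means moving that index from one subset to the other, which
preserves χ_I + χ_J; only the spin energies change. -/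
theorem weight_add_weight_le (φ ψ φ' ψ' : ι → ℝ) (B : ι → ι → ℝ) (hB : ∀ i j, B i j = B j i)
    (hφ : ∀ i, φ i + ψ i = φ' i + ψ' i) (I J : Finset ι) (τ : ι → ℤ)
    (hτ : ∀ i, τ i = chi I i - chi J i ∨ τ i = -(chi I i - chi J i)) :
    4 * (weight φ B I + weight ψ B J) -
        spinEnergy (fun i => φ i - ψ i) B (fun i => chi I i - chi J i) ≤
      4 * (maxWeight φ' B + maxWeight ψ' B) - spinEnergy (fun i => φ' i - ψ' i) B τ := by
  let I' : Finset ι := {i | if τ i = chi I i - chi J i then i ∈ I else i ∈ J}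
  let J' : Finset ι := {i | if τ i = chi I i - chi J i then i ∈ J else i ∈ I}
  have hI : ∀ i, chi I' i = if τ i = chi I i - chi J i then chi I i else chi J i := by
    intro i
    by_cases h : τ i = chi I i - chi J i
    · rw [if_pos h, chi, chi]; simp only [I', Finset.mem_filter_univ, if_pos h]
    · rw [if_neg h, chi, chi]; simp only [I', Finset.mem_filter_univ, if_neg h]
  have hJ : ∀ i, chi J' i = if τ i = chi I i - chi J i then chi J i else chi I i := by
    intro i
    by_cases h : τ i = chi I i - chi J i
    · rw [if_pos h, chi, chi]; simp only [J', Finset.mem_filter_univ, if_pos h]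
    · rw [if_neg h, chi, chi]; simp only [J', Finset.mem_filter_univ, if_neg h]
  have h1 : ∀ i, chi I' i + chi J' i = chi I i + chi J i := by
    intro i
    rw [hI, hJ]
    split_ifs <;> ring
  have h2 : (fun i => chi I' i - chi J' i) = τ := by
    funext i
    rw [hI, hJ]
    split_ifs with h
    · exact h.symm
    · rw [(hτ i).resolve_left h]; ring
  have h3 := weight_add_weight φ' ψ' B hB I' J'
  rw [h2] at h3
  simp only [h1, ← hφ] at h3
  have h4 := weight_add_weight φ ψ B hB I J
  have h5 := weight_le_maxWeight φ' B I'
  have h6 := weight_le_maxWeight ψ' B J'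
  linarith

end Pairs

/-! ### Sign assignments with prescribed sums over upper level sets -/

section Policies

variable {ι : Type*}

/-- A path of integers starting at `0` with steps `1` and `-1`. -/
def IsPath (g : ℕ → ℤ) : Prop :=
  g 0 = 0 ∧ ∀ n, g (n + 1) - g n = 1 ∨ g (n + 1) - g n = -1

theorem IsPath.neg {g : ℕ → ℤ} (h : IsPath g) : IsPath fun n => -g n := by
  refine ⟨by simp [h.1], fun n => ?_⟩
  have := h.2 n
  change -g (n + 1) - -g n = 1 ∨ -g (n + 1) - -g n = -1
  omega

/-- List the elements by decreasing q and give the k-th one the k-th step of g. Sets closed upwards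
in q are initial segments of the list, so their sums are values of g. -/
theorem exists_spin_of_path [DecidableEq ι] (D : Finset ι) (q : ι → ℝ) (g : ℕ → ℤ) (hg : IsPath g) :
    ∃ t : ι → ℤ, (∀ i, t i = 1 ∨ t i = -1) ∧
      ∀ A ⊆ D, (∀ i ∈ A, ∀ j ∈ D, q i ≤ q j → j ∈ A) → ∑ i ∈ A, t i = g A.card := by
  induction D using Finset.induction_on_min_value q with
  | empty => exact ⟨fun _ => 1, fun _ => Or.inl rfl, fun A hA _ => by
      rw [Finset.subset_empty.mp hA]; simp [hg.1]⟩
  | insert a D ha hmin ih =>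
    obtain ⟨t, ht, hA⟩ := ih
    -- The new element has the least q, so it takes the last step; an upward closed set containing
    -- it is everything.
    refine ⟨Function.update t a (g (D.card + 1) - g D.card), ?_, ?_⟩
    · intro i
      by_cases h : i = a
      · subst h; simpa using hg.2 _
      · simpa [h] using ht i
    · intro A hAD hup
      have hoff : ∀ E ⊆ D, ∑ i ∈ E, Function.update t a (g (D.card + 1) - g D.card) i =
          ∑ i ∈ E, t i := by
        intro E hE
        refine Finset.sum_congr rfl fun i hi => ?_
        rw [Function.update_of_ne]
        rintro rfl
        exact ha (hE hi)
      by_cases haA : a ∈ A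
      · have hAe : A = insert a D := by
          refine Finset.Subset.antisymm hAD fun j hj => ?_
          rcases Finset.mem_insert.mp hj with h | h
          · exact h ▸ haA
          · exact hup a haA j hj (hmin j h)
        rw [hAe, Finset.sum_insert ha, hoff D subset_rfl, Finset.card_insert_of_notMem ha,
          hA D subset_rfl fun _ _ j hj _ => hj]
        simp
      · have hAD' : A ⊆ D := fun i hi => by
          rcases Finset.mem_insert.mp (hAD hi) with h | h
          · exact absurd (h ▸ hi) haA
          · exact h
        rw [hoff A hAD']
        exact hA A hAD' fun i hi j hj => hup i hi j (Finset.mem_insert_of_mem hj)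

variable [Fintype ι]

/-- The number of nonzero spins whose parameter is selected by the threshold function `f`. -/
def count (τ : ι → ℤ) (q : ι → ℝ) (f : ℝ → ℤ) : ℕ :=
  (Finset.univ.filter fun i => τ i ≠ 0 ∧ f (q i) = 1).card

/-- A monotone `0/1`-valued function vanishing at `0`. -/
structure IsThreshold (f : ℝ → ℤ) : Prop where
  mono : Monotone f
  zero_or_one : ∀ x, f x = 0 ∨ f x = 1
  at_zero : f 0 = 0

theorem IsThreshold.pos_of_eq_one {f : ℝ → ℤ} (hf : IsThreshold f) {x : ℝ} (hx : f x = 1) :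
    0 < x := by
  by_contra! h
  have := hf.mono h
  rw [hx, hf.at_zero] at this
  omega

theorem sum_threshold (τ : ι → ℤ) (q : ι → ℝ) {f : ℝ → ℤ} (hf : ∀ x, f x = 0 ∨ f x = 1) :
    ∑ i, τ i * f (q i) = ∑ i with τ i ≠ 0 ∧ f (q i) = 1, τ i := by
  rw [Finset.sum_filter]
  refine Finset.sum_congr rfl fun i _ => ?_
  rcases hf (q i) with h | h
  · simp [h]
  · by_cases h' : τ i = 0 <;> simp [h, h']

theorem sum_threshold_parity (τ : ι → ℤ) (hτ : ∀ i, τ i = 0 ∨ τ i = 1 ∨ τ i = -1) (q : ι → ℝ)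
    {f : ℝ → ℤ} (hf : ∀ x, f x = 0 ∨ f x = 1) :
    (∑ i, τ i * f (q i)) % 2 = (count τ q f : ℤ) % 2 := by
  rw [sum_threshold τ q hf, count, Finset.card_eq_sum_ones]
  push_cast
  apply Int.emod_eq_emod_iff_emod_sub_eq_zero.mpr
  apply Int.emod_eq_zero_of_dvd
  rw [← Finset.sum_sub_distrib]
  refine Finset.dvd_sum fun i hi => ?_
  have := (Finset.mem_filter.mp hi).2.1
  rcases hτ i with h | h | h
  · exact absurd h this
  · simp [h]
  · simp [h]

/-- Thresholds select only positive parameters, and no index has both ω and p positive, so the two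
families of signs can be chosen independently. Zero spins stay zero, hence the counts are those of
τ. -/
theorem exists_spins_of_paths [DecidableEq ι] (τ : ι → ℤ)
    (hτ : ∀ i, τ i = 0 ∨ τ i = 1 ∨ τ i = -1) (ω p : ι → ℝ)
    (hωp : ∀ i, ω i = 0 ∨ p i = 0) (gS gT : ℕ → ℤ)
    (hS : IsPath gS) (hT : IsPath gT) :
    ∃ τ' : ι → ℤ, (∀ i, τ' i = τ i ∨ τ' i = -τ i) ∧
      (∀ f, IsThreshold f → ∑ i, τ' i * f (ω i) = gS (count τ ω f)) ∧
      (∀ f, IsThreshold f → ∑ i, τ' i * f (p i) = gT (count τ p f)) := by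
  obtain ⟨s, hs, hsA⟩ := exists_spin_of_path (Finset.univ.filter fun i => τ i ≠ 0) ω gS hS
  obtain ⟨t, ht, htA⟩ := exists_spin_of_path (Finset.univ.filter fun i => τ i ≠ 0) p gT hT
  let τ' : ι → ℤ := fun i => if τ i = 0 then 0 else if 0 < ω i then s i else t i
  have h0 : ∀ i, τ' i = 0 ↔ τ i = 0 := by
    intro i
    rcases hs i with h | h <;> rcases ht i with h' | h' <;> by_cases h0 : τ i = 0 <;>
      by_cases h1 : 0 < ω i <;> simp [τ', h, h', h0, h1]
  refine ⟨τ', ?_, ?_, ?_⟩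
  · intro i
    rcases hs i with h | h <;> rcases ht i with h' | h' <;> rcases hτ i with h0 | h0 | h0 <;>
      by_cases h1 : 0 < ω i <;> simp [τ', h, h', h0, h1]
  · intro f hf
    rw [sum_threshold τ' ω hf.zero_or_one, count]
    simp only [ne_eq, h0]
    rw [← hsA]
    · refine Finset.sum_congr rfl fun i hi => ?_
      obtain ⟨h1, h2⟩ := (Finset.mem_filter.mp hi).2
      simp [τ', h1, hf.pos_of_eq_one h2]
    · intro i hi
      simp only [Finset.mem_filter] at hi ⊢
      exact ⟨hi.1, hi.2.1⟩
    · intro i hi j hj hij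
      simp only [Finset.mem_filter] at hi hj ⊢
      refine ⟨hj.1, hj.2, ?_⟩
      have := hf.mono hij
      rcases hf.zero_or_one (ω j) with h | h <;> omega
  · intro f hf
    rw [sum_threshold τ' p hf.zero_or_one, count]
    simp only [ne_eq, h0]
    rw [← htA]
    · refine Finset.sum_congr rfl fun i hi => ?_
      obtain ⟨h1, h2⟩ := (Finset.mem_filter.mp hi).2
      have hω : ω i = 0 := (hωp i).resolve_right (hf.pos_of_eq_one h2).ne'
      simp [τ', h1, hω]
    · intro i hi
      simp only [Finset.mem_filter] at hi ⊢
      exact ⟨hi.1, hi.2.1⟩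
    · intro i hi j hj hij
      simp only [Finset.mem_filter] at hi hj ⊢
      refine ⟨hj.1, hj.2, ?_⟩
      have := hf.mono hij
      rcases hf.zero_or_one (p j) with h | h <;> omega

end Policies

/-! ### Layer-cake representation of fields and couplings -/

section Layers

open MeasureTheory

/-- The function `f` is integrable on the line with integral `c`. -/
def HasInt (f : ℝ → ℝ) (c : ℝ) : Prop := Integrable f ∧ ∫ u, f u = c

theorem HasInt.add {f g : ℝ → ℝ} {c d : ℝ} (hf : HasInt f c) (hg : HasInt g d) :
    HasInt (fun u => f u + g u) (c + d) :=
  ⟨hf.1.add hg.1, by rw [integral_add hf.1 hg.1, hf.2, hg.2]⟩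

theorem HasInt.sub {f g : ℝ → ℝ} {c d : ℝ} (hf : HasInt f c) (hg : HasInt g d) :
    HasInt (fun u => f u - g u) (c - d) :=
  ⟨hf.1.sub hg.1, by rw [integral_sub hf.1 hg.1, hf.2, hg.2]⟩

theorem HasInt.const_mul {f : ℝ → ℝ} {c : ℝ} (hf : HasInt f c) (a : ℝ) :
    HasInt (fun u => a * f u) (a * c) :=
  ⟨hf.1.const_mul a, by rw [integral_const_mul, hf.2]⟩

theorem HasInt.sum {ι : Type*} (s : Finset ι) {f : ι → ℝ → ℝ} {c : ι → ℝ}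
    (hf : ∀ i, HasInt (f i) (c i)) : HasInt (fun u => ∑ i ∈ s, f i u) (∑ i ∈ s, c i) :=
  ⟨integrable_finsetSum s fun i _ => (hf i).1, by
    rw [integral_finsetSum s fun i _ => (hf i).1]
    exact Finset.sum_congr rfl fun i _ => (hf i).2⟩

theorem HasInt.mono {f g : ℝ → ℝ} {c d : ℝ} (hf : HasInt f c) (hg : HasInt g d)
    (h : ∀ u, f u ≤ g u) : c ≤ d := by
  rw [← hf.2, ← hg.2]
  exact integral_mono hf.1 hg.1 h

theorem HasInt.congr {f g : ℝ → ℝ} {c d : ℝ} (hf : HasInt f c) (h : ∀ u, g u = f u)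
    (hcd : d = c) : HasInt g d := by
  have : g = f := funext h
  rw [this, hcd]
  exact hf

/-- The indicator of the interval `(a, b]`. -/
def cell (a b u : ℝ) : ℤ := if a < u ∧ u ≤ b then 1 else 0

theorem hasInt_cell_mul (a b c d : ℝ) :
    HasInt (fun u => (cell a b u : ℝ) * cell c d u) (max (min b d - max a c) 0) := by
  have h : (fun u => (cell a b u : ℝ) * cell c d u) =
      (Set.Ioc (max a c) (min b d)).indicator 1 := by
    funext u
    by_cases h1 : a < u ∧ u ≤ b <;> by_cases h2 : c < u ∧ u ≤ d
    · have : u ∈ Set.Ioc (max a c) (min b d) :=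
        ⟨max_lt h1.1 h2.1, le_min h1.2 h2.2⟩
      simp [cell, h1, h2, this]
    all_goals
      have : u ∉ Set.Ioc (max a c) (min b d) := by
        rintro ⟨h3, h4⟩
        have := max_lt_iff.mp h3
        have := le_min_iff.mp h4
        tauto
      simp [cell, h1, h2, this]
  rw [h]
  refine ⟨?_, ?_⟩
  · exact (integrable_indicator_iff measurableSet_Ioc).mpr (by
      rw [Pi.one_def]
      exact integrableOn_const (by simp))
  · rw [integral_indicator_one measurableSet_Ioc, Real.volume_real_Ioc]

theorem hasInt_cell (a b : ℝ) : HasInt (fun u => (cell a b u : ℝ)) (max (b - a) 0) := by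
  refine (hasInt_cell_mul a b a b).congr (fun u => ?_) (by simp)
  by_cases h : a < u ∧ u ≤ b <;> simp [cell, h]

theorem cell_zero_or_one (a b u : ℝ) : cell a b u = 0 ∨ cell a b u = 1 := by
  unfold cell
  split_ifs <;> simp

theorem cell_eq_zero {a b u : ℝ} (h : ¬(a < u ∧ u ≤ b)) : cell a b u = 0 := if_neg h

theorem cell_eq_one {a b u : ℝ} (h1 : a < u) (h2 : u ≤ b) : cell a b u = 1 := if_pos ⟨h1, h2⟩

theorem cell_le_cell {a b u a' b' u' : ℝ} (h : a < u → u ≤ b → a' < u' ∧ u' ≤ b') :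
    cell a b u ≤ cell a' b' u' := by
  by_cases h1 : a < u ∧ u ≤ b
  · rw [cell_eq_one h1.1 h1.2, cell_eq_one (h h1.1 h1.2).1 (h h1.1 h1.2).2]
  · rw [cell_eq_zero h1]
    rcases cell_zero_or_one a' b' u' with h | h <;> omega

/-- Left continuity, from the convention (a, b]; it is what makes the supremum of the bad heights
itself bad. -/
theorem cell_eventually_eq (a b s : ℝ) :
    ∀ᶠ u in nhdsWithin s (Set.Iic s), cell a b u = cell a b s := by
  have hself : ∀ᶠ u in nhdsWithin s (Set.Iic s), u ≤ s := eventually_mem_nhdsWithin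
  rcases le_or_gt s a with h | h
  · filter_upwards [hself] with u hu
    rw [cell_eq_zero, cell_eq_zero] <;> intro h' <;> linarith [h'.1]
  · have ha : ∀ᶠ u in nhdsWithin s (Set.Iic s), a < u :=
      Filter.Eventually.filter_mono nhdsWithin_le_nhds (eventually_gt_nhds h)
    rcases le_or_gt s b with h' | h'
    · filter_upwards [hself, ha] with u hu hau
      rw [cell_eq_one hau (hu.trans h'), cell_eq_one h h']
    · filter_upwards [Filter.Eventually.filter_mono nhdsWithin_le_nhds (eventually_gt_nhds h')]
        with u hu
      rw [cell_eq_zero, cell_eq_zero] <;> intro h'' <;> linarith [h''.2]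

variable (δ₁ δ₂ : ℝ)

/-- Levels of KdV type below `δ₁`, listed by `δ₂ - u`. -/
def lowK (u ω : ℝ) : ℤ := cell (max (δ₂ - ω) (δ₂ - δ₁)) δ₂ u

/-- Levels of KdV type between `δ₁` and `2 δ₁`, listed by `u - δ₂ + 2 δ₁`. -/
def midK (u ω : ℝ) : ℤ := cell (δ₂ - δ₁) (min (δ₂ - 2 * δ₁ + ω) δ₂) u

/-- Levels of KdV type above `2 δ₁`, listed by `2 (u - δ₂) + 2 δ₁`. -/
def highK (u ω : ℝ) : ℤ := cell δ₂ (δ₂ + (ω - 2 * δ₁) / 2) u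

/-- Levels of Toda type below `δ₂ - δ₁`. -/
def lowT (u p : ℝ) : ℤ := cell 0 (min p (δ₂ - δ₁)) u

/-- Levels of Toda type between `δ₂ - δ₁` and `δ₂`. -/
def midT (u p : ℝ) : ℤ := cell (δ₂ - δ₁) (min p δ₂) u

/-- Levels of Toda type above `δ₂`. -/
def highT (u p : ℝ) : ℤ := cell δ₂ p u

/-- The velocity-weighted field of a soliton with parameters `ω`, `p ≥ 0` along `(a, b)`. -/
def field (a b : ℤ) (ω p : ℝ) : ℝ :=
  a * (ω + dispQ δ₂ p) + b * (p + dispK δ₁ ω)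

/-- The interaction of solitons with nonnegative parameters `(ω, p)` and `(ω', p')`. -/
def coupling (ω p ω' p' : ℝ) : ℝ :=
  -2 * min ω ω' - (2 * min p p' + dispQ δ₂ (min p p')) +
    (interMixed δ₁ δ₂ ω p' + interMixed δ₁ δ₂ ω' p)

theorem coupling_comm (ω p ω' p' : ℝ) :
    coupling δ₁ δ₂ ω p ω' p' = coupling δ₁ δ₂ ω' p' ω p := by
  rw [coupling, coupling, min_comm ω, min_comm p]; ring

/-- The energy density of a layer with spin sums `x`, `y`, `s` (KdV type, low, middle and high
levels) and `r`, `z`, `t` (Toda type, low, middle and high levels). -/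
def density (a b x y s r z t : ℤ) : ℤ :=
  2 * ((a - b) * x + a * y + 2 * a * s + b * r + b * z + (a + b) * t) -
    ((x - z) ^ 2 + (y + z) ^ 2 + x ^ 2 + y ^ 2 + 2 * s ^ 2 + 2 * (s + t) ^ 2 + t ^ 2 + 2 * r ^ 2)

variable {δ₁ δ₂}

/-- The low KdV levels have total length min(ω, δ₁) = −K. High levels are compressed by a factor 2,
hence their weight 2a. For Toda type the three lengths add up to p and the highest one is Q. -/
theorem hasInt_field (hδ₁ : 0 < δ₁) (hδ₂ : δ₁ < δ₂) (a b : ℤ) {ω p : ℝ} (hω : 0 ≤ ω) (hp : 0 ≤ p) :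
    HasInt (fun u => ((a - b : ℤ) : ℝ) * lowK δ₁ δ₂ u ω + (a : ℝ) * midK δ₁ δ₂ u ω +
      ((2 * a : ℤ) : ℝ) * highK δ₁ δ₂ u ω + (b : ℝ) * lowT δ₁ δ₂ u p + (b : ℝ) * midT δ₁ δ₂ u p +
      ((a + b : ℤ) : ℝ) * highT δ₂ u p) (field δ₁ δ₂ a b ω p) := by
  have h := ((((((hasInt_cell (max (δ₂ - ω) (δ₂ - δ₁)) δ₂).const_mul ((a - b : ℤ) : ℝ)).add
    ((hasInt_cell (δ₂ - δ₁) (min (δ₂ - 2 * δ₁ + ω) δ₂)).const_mul (a : ℝ))).add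
    ((hasInt_cell δ₂ (δ₂ + (ω - 2 * δ₁) / 2)).const_mul ((2 * a : ℤ) : ℝ))).add
    ((hasInt_cell 0 (min p (δ₂ - δ₁))).const_mul (b : ℝ))).add
    ((hasInt_cell (δ₂ - δ₁) (min p δ₂)).const_mul (b : ℝ))).add
    ((hasInt_cell δ₂ p).const_mul ((a + b : ℤ) : ℝ))
  refine h.congr (fun u => rfl) ?_
  have e1 : max (δ₂ - max (δ₂ - ω) (δ₂ - δ₁)) 0 = -dispK δ₁ ω := by
    rw [dispK]; grind
  have e2 : max (min (δ₂ - 2 * δ₁ + ω) δ₂ - (δ₂ - δ₁)) 0 +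
      2 * max (δ₂ + (ω - 2 * δ₁) / 2 - δ₂) 0 = ω + dispK δ₁ ω := by
    rw [dispK]; grind
  have e3 : max (min p (δ₂ - δ₁) - 0) 0 + max (min p δ₂ - (δ₂ - δ₁)) 0 + max (p - δ₂) 0 = p := by
    grind
  have e4 : max (p - δ₂) 0 = dispQ δ₂ p := by
    rw [dispQ]; grind
  rw [field]
  push_cast
  linear_combination (b - a) * e1 - a * e2 - b * e3 - a * e4

/-- Low levels are reversed and middle levels shifted so that both share the interval (δ₂ − δ₁, δ₂]
with the middle Toda levels. The mixed interaction then becomes a signed overlap: low with middle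
Toda, minus middle with middle Toda, minus twice high with high Toda. The cross terms fit into the
products, so minus the coupling is a Gram form. -/
theorem hasInt_coupling (hδ₁ : 0 < δ₁) (hδ₂ : δ₁ < δ₂) {ω p ω' p' : ℝ} (hω : 0 ≤ ω) (hp : 0 ≤ p)
    (hω' : 0 ≤ ω') (hp' : 0 ≤ p') :
    HasInt (fun u =>
      ((lowK δ₁ δ₂ u ω : ℝ) - midT δ₁ δ₂ u p) * (lowK δ₁ δ₂ u ω' - midT δ₁ δ₂ u p') +
      ((midK δ₁ δ₂ u ω : ℝ) + midT δ₁ δ₂ u p) * (midK δ₁ δ₂ u ω' + midT δ₁ δ₂ u p') +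
      (lowK δ₁ δ₂ u ω : ℝ) * lowK δ₁ δ₂ u ω' + (midK δ₁ δ₂ u ω : ℝ) * midK δ₁ δ₂ u ω' +
      2 * ((highK δ₁ δ₂ u ω : ℝ) * highK δ₁ δ₂ u ω') +
      2 * (((highK δ₁ δ₂ u ω : ℝ) + highT δ₂ u p) * (highK δ₁ δ₂ u ω' + highT δ₂ u p')) +
      (highT δ₂ u p : ℝ) * highT δ₂ u p' +
      2 * ((lowT δ₁ δ₂ u p : ℝ) * lowT δ₁ δ₂ u p')) (-coupling δ₁ δ₂ ω p ω' p') := by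
  have mixed : ∀ ω p : ℝ, 0 ≤ ω → 0 ≤ p → HasInt (fun u =>
      (lowK δ₁ δ₂ u ω : ℝ) * midT δ₁ δ₂ u p - (midK δ₁ δ₂ u ω : ℝ) * midT δ₁ δ₂ u p -
        2 * ((highK δ₁ δ₂ u ω : ℝ) * highT δ₂ u p)) (interMixed δ₁ δ₂ ω p) := by
    intro ω p hω hp
    refine (((hasInt_cell_mul _ _ _ _).sub (hasInt_cell_mul _ _ _ _)).sub
      ((hasInt_cell_mul _ _ _ _).const_mul 2)).congr (fun u => rfl) ?_
    rcases hω.eq_or_lt with rfl | hω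
    · simp only [interMixed, lt_irrefl, false_and, if_false]
      grind
    rcases hp.eq_or_lt with rfl | hp
    · simp only [interMixed, lt_irrefl, and_false, if_false]
      grind
    have e1 : dispK δ₁ ω = - min ω δ₁ := by rw [dispK]; grind
    have e2 : dispQ δ₂ p = max 0 (p - δ₂) := by rw [dispQ]; grind
    rw [interMixed, if_pos ⟨hω, hp⟩, e1, e2]
    rcases le_total p δ₂ with h | h <;> rcases le_total ω δ₁ with h' | h' <;>
      grind (splits := 20)
  have kdv : HasInt (fun u => (lowK δ₁ δ₂ u ω : ℝ) * lowK δ₁ δ₂ u ω' +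
      (midK δ₁ δ₂ u ω : ℝ) * midK δ₁ δ₂ u ω' +
      2 * ((highK δ₁ δ₂ u ω : ℝ) * highK δ₁ δ₂ u ω')) (min ω ω') := by
    refine (((hasInt_cell_mul _ _ _ _).add (hasInt_cell_mul _ _ _ _)).add
      ((hasInt_cell_mul _ _ _ _).const_mul 2)).congr (fun u => rfl) ?_
    grind
  have toda : HasInt (fun u => 2 * ((midT δ₁ δ₂ u p : ℝ) * midT δ₁ δ₂ u p') +
      3 * ((highT δ₂ u p : ℝ) * highT δ₂ u p') +
      2 * ((lowT δ₁ δ₂ u p : ℝ) * lowT δ₁ δ₂ u p')) (2 * min p p' + dispQ δ₂ (min p p')) := by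
    refine ((((hasInt_cell_mul _ _ _ _).const_mul 2).add
      ((hasInt_cell_mul _ _ _ _).const_mul 3)).add
      ((hasInt_cell_mul _ _ _ _).const_mul 2)).congr (fun u => rfl) ?_
    rw [dispQ]
    grind
  refine (((kdv.const_mul 2).add toda).sub ((mixed ω p' hω hp').add (mixed ω' p hω' hp))).congr
    (fun u => by ring) ?_
  rw [coupling]
  ring

/-- A Gram form summed against τ_i τ_j is a sum of squares of spin sums, so the whole energy
localises in u. -/
theorem hasInt_density {ι : Type*} [Fintype ι] (hδ₁ : 0 < δ₁) (hδ₂ : δ₁ < δ₂) (a b : ℤ)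
    {ω p : ι → ℝ} (hω : ∀ i, 0 ≤ ω i) (hp : ∀ i, 0 ≤ p i) (τ : ι → ℤ) :
    HasInt (fun u => (density a b (∑ i, τ i * lowK δ₁ δ₂ u (ω i)) (∑ i, τ i * midK δ₁ δ₂ u (ω i))
        (∑ i, τ i * highK δ₁ δ₂ u (ω i)) (∑ i, τ i * lowT δ₁ δ₂ u (p i))
        (∑ i, τ i * midT δ₁ δ₂ u (p i)) (∑ i, τ i * highT δ₂ u (p i)) : ℝ))
      (spinEnergy (fun i => field δ₁ δ₂ a b (ω i) (p i))
        (fun i j => coupling δ₁ δ₂ (ω i) (p i) (ω j) (p j)) τ) := by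
  have h1 := (HasInt.sum Finset.univ fun i =>
    (hasInt_field hδ₁ hδ₂ a b (hω i) (hp i)).const_mul (τ i : ℝ)).const_mul 2
  have h2 := HasInt.sum Finset.univ fun i => HasInt.sum Finset.univ fun j =>
    (hasInt_coupling hδ₁ hδ₂ (hω i) (hp i) (hω j) (hp j)).const_mul ((τ i : ℝ) * τ j)
  refine (h1.sub h2).congr (fun u => ?_) ?_
  · have hlin : ∀ (f₁ f₂ f₃ f₄ f₅ f₆ : ι → ℝ) (c₁ c₂ c₃ c₄ c₅ c₆ : ℝ),
        ∑ i, (τ i : ℝ) * (c₁ * f₁ i + c₂ * f₂ i + c₃ * f₃ i + c₄ * f₄ i + c₅ * f₅ i + c₆ * f₆ i) =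
        c₁ * ∑ i, τ i * f₁ i + c₂ * ∑ i, τ i * f₂ i + c₃ * ∑ i, τ i * f₃ i +
        c₄ * ∑ i, τ i * f₄ i + c₅ * ∑ i, τ i * f₅ i + c₆ * ∑ i, τ i * f₆ i := by
      intros
      simp only [Finset.mul_sum, ← Finset.sum_add_distrib]
      exact Finset.sum_congr rfl fun i _ => by ring
    have hsq : ∀ f : ι → ℝ, ∑ i, ∑ j, (τ i : ℝ) * τ j * (f i * f j) = (∑ i, τ i * f i) ^ 2 := by
      intro f
      rw [pow_two, Finset.sum_mul_sum]
      exact Finset.sum_congr rfl fun i _ => Finset.sum_congr rfl fun j _ => by ring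
    have hadd : ∀ f g : ι → ℝ, ∑ i, (τ i : ℝ) * (f i + g i) = ∑ i, τ i * f i + ∑ i, τ i * g i := by
      intro f g
      simp only [mul_add, Finset.sum_add_distrib]
    have hsub : ∀ f g : ι → ℝ, ∑ i, (τ i : ℝ) * (f i - g i) = ∑ i, τ i * f i - ∑ i, τ i * g i := by
      intro f g
      simp only [mul_sub, Finset.sum_sub_distrib]
    have hquad : ∀ f₁ f₂ f₃ f₄ f₅ f₆ f₇ f₈ : ι → ℝ,
        ∑ i, ∑ j, (τ i : ℝ) * τ j * (f₁ i * f₁ j + f₂ i * f₂ j + f₃ i * f₃ j + f₄ i * f₄ j +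
          2 * (f₅ i * f₅ j) + 2 * (f₆ i * f₆ j) + f₇ i * f₇ j + 2 * (f₈ i * f₈ j)) =
        (∑ i, τ i * f₁ i) ^ 2 + (∑ i, τ i * f₂ i) ^ 2 + (∑ i, τ i * f₃ i) ^ 2 +
          (∑ i, τ i * f₄ i) ^ 2 + 2 * (∑ i, τ i * f₅ i) ^ 2 + 2 * (∑ i, τ i * f₆ i) ^ 2 +
          (∑ i, τ i * f₇ i) ^ 2 + 2 * (∑ i, τ i * f₈ i) ^ 2 := by
      intros
      simp only [← hsq, Finset.mul_sum, ← Finset.sum_add_distrib]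
      exact Finset.sum_congr rfl fun i _ => Finset.sum_congr rfl fun j _ => by ring
    have e := hquad (fun i => (lowK δ₁ δ₂ u (ω i) : ℝ) - midT δ₁ δ₂ u (p i))
      (fun i => (midK δ₁ δ₂ u (ω i) : ℝ) + midT δ₁ δ₂ u (p i)) (fun i => lowK δ₁ δ₂ u (ω i))
      (fun i => midK δ₁ δ₂ u (ω i)) (fun i => highK δ₁ δ₂ u (ω i))
      (fun i => (highK δ₁ δ₂ u (ω i) : ℝ) + highT δ₂ u (p i)) (fun i => highT δ₂ u (p i))
      (fun i => lowT δ₁ δ₂ u (p i))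
    rw [hadd, hadd, hsub] at e
    rw [e, hlin, density]
    push_cast
    ring
  · rw [spinEnergy]
    simp only [mul_neg, Finset.sum_neg_distrib, sub_neg_eq_add]

end Layers

/-! ### Integer optimisation within a single layer -/

section Counts

/-- Numbers of nonzero spins at the levels of one layer. -/
structure Counts where
  x : ℕ
  y : ℕ
  s : ℕ
  r : ℕ
  z : ℕ
  t : ℕ

/-- The density of a layer whose spin sums follow the paths `gS` and `gT`. -/
def Counts.density (a b : ℤ) (gS gT : ℕ → ℤ) (c : Counts) : ℤ :=
  MixedSoliton.density a b (gS c.x) (gS c.y) (gS c.s) (gT c.r) (gT c.z) (gT c.t)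

/-- The layers on which the optimal configurations for `(2, 1)` and `(0, 1)` differ. -/
def Counts.Bad (c : Counts) : Prop :=
  c.s % 2 = 1 ∨ c.t % 2 = 1 ∨ (c.x % 2 = 1 ∧ c.z % 2 = 1) ∨ (c.y % 2 = 1 ∧ c.z % 2 = 0)

/-- The three kinds of layers: high, middle and low; `κ` and `κ'` are the indicators of the
middle and of the low layers. -/
def Counts.IsLayer (c : Counts) (κ κ' : ℤ) : Prop :=
  (c.x = 0 ∧ c.y = 0 ∧ c.r = 0 ∧ c.z = 0 ∧ κ = 0 ∧ κ' = 0) ∨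
  (c.s = 0 ∧ c.r = 0 ∧ c.t = 0 ∧ κ = 1 ∧ κ' = 0) ∨
  (c.x = 0 ∧ c.y = 0 ∧ c.s = 0 ∧ c.z = 0 ∧ c.t = 0 ∧ κ = 0 ∧ κ' = 1)

theorem sq_le_sq_of_parity {w v : ℤ} (h : w % 2 = v % 2) (h1 : -1 ≤ v) (h2 : v ≤ 1) :
    v ^ 2 ≤ w ^ 2 := by
  rcases eq_or_ne v 0 with rfl | hv
  · positivity
  · have hw : w ≠ 0 := by rintro rfl; omega
    have h3 : v ^ 2 = 1 := by
      have : v = 1 ∨ v = -1 := by omega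
      rcases this with rfl | rfl <;> norm_num
    rw [h3]
    have := sq_pos_of_ne_zero hw
    omega

/-- The path `0, 1, 0, 1, …`. -/
def parity (n : ℕ) : ℤ := (n : ℤ) % 2

theorem parity_eq (n : ℕ) : (n % 2 = 0 ∧ parity n = 0) ∨ (n % 2 = 1 ∧ parity n = 1) := by
  unfold parity
  omega

theorem parity_zero : parity 0 = 0 := rfl

/-- The integer `w` has the parity of `n`, and vanishes if `n` does. -/
def Compat (w : ℤ) (n : ℕ) : Prop := w % 2 = (n : ℤ) % 2 ∧ (n = 0 → w = 0)

variable {c : Counts} {x y s r z t κ κ' : ℤ}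

/-- Completing squares for (2,1) gives centres x − z = 0, y + z = 1, x = y = 1, s = 1, s + t = 1, t
= 1. At the 0/1 parities every deviation lies in {−1, 0, 1}, so all squares are minimal in their
parity classes simultaneously. The r part 2r − 2r² is at most 0. -/
theorem density_two_one_le (hx : Compat x c.x) (hy : Compat y c.y) (hs : Compat s c.s)
    (hz : Compat z c.z) (ht : Compat t c.t) :
    density 2 1 x y s r z t ≤ c.density 2 1 parity parity := by
  have hr := Int.le_self_sq r
  have hr' : parity c.r ^ 2 = parity c.r := by rcases parity_eq c.r with h | h <;> simp [h.2]
  have px := parity_eq c.x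
  have py := parity_eq c.y
  have ps := parity_eq c.s
  have pz := parity_eq c.z
  have pt := parity_eq c.t
  unfold Compat at *
  have h1 : (parity c.x - parity c.z) ^ 2 ≤ (x - z) ^ 2 :=
    sq_le_sq_of_parity (by omega) (by omega) (by omega)
  have h2 : (parity c.y + parity c.z - 1) ^ 2 ≤ (y + z - 1) ^ 2 :=
    sq_le_sq_of_parity (by omega) (by omega) (by omega)
  have h3 : (parity c.x - 1) ^ 2 ≤ (x - 1) ^ 2 :=
    sq_le_sq_of_parity (by omega) (by omega) (by omega)
  have h4 : (parity c.y - 1) ^ 2 ≤ (y - 1) ^ 2 :=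
    sq_le_sq_of_parity (by omega) (by omega) (by omega)
  have h5 : (parity c.s - 1) ^ 2 ≤ (s - 1) ^ 2 :=
    sq_le_sq_of_parity (by omega) (by omega) (by omega)
  have h6 : (parity c.s + parity c.t - 1) ^ 2 ≤ (s + t - 1) ^ 2 :=
    sq_le_sq_of_parity (by omega) (by omega) (by omega)
  have h7 : (parity c.t - 1) ^ 2 ≤ (t - 1) ^ 2 :=
    sq_le_sq_of_parity (by omega) (by omega) (by omega)
  unfold Counts.density density
  linarith

theorem density_zero_one_le (hx : Compat x c.x) (hy : Compat y c.y)
    (hz : Compat z c.z) (ht : Compat t c.t) :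
    density 0 1 x y s r z t ≤ c.density 2 1 parity parity := by
  have hr := Int.le_self_sq r
  have hr' : parity c.r ^ 2 = parity c.r := by rcases parity_eq c.r with h | h <;> simp [h.2]
  have px := parity_eq c.x
  have py := parity_eq c.y
  have ps := parity_eq c.s
  have pz := parity_eq c.z
  have pt := parity_eq c.t
  unfold Compat at *
  have h7 : (parity c.t - 1) ^ 2 ≤ (t - 1) ^ 2 :=
    sq_le_sq_of_parity (by omega) (by omega) (by omega)
  have h5 : 0 ≤ s ^ 2 := sq_nonneg s
  have h6 : 0 ≤ (s + t) ^ 2 := sq_nonneg _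
  have h5' : 0 ≤ 2 * parity c.s - parity c.s ^ 2 := by
    rcases ps with h | h <;> simp [h.2]
  have h6' : 0 ≤ 2 * (parity c.s + parity c.t) - (parity c.s + parity c.t) ^ 2 := by
    rcases ps with h | h <;> rcases pt with h' | h' <;> simp [h.2, h'.2]
  have key : -2 * (x - z) - (x - z) ^ 2 - (y + z) ^ 2 - x ^ 2 - y ^ 2 ≤
      2 * parity c.x + 4 * parity c.y + 2 * parity c.z - (parity c.x - parity c.z) ^ 2 -
        (parity c.y + parity c.z) ^ 2 - parity c.x ^ 2 - parity c.y ^ 2 := by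
    -- For (0,1) the terms in x − z complete to a square centred at −1; its least value is decided
    -- by the parity of x + z + 1.
    have g1 : parity (c.x + c.z + 1) ^ 2 ≤ (x - z + 1) ^ 2 :=
      sq_le_sq_of_parity (by unfold parity; push_cast; omega) (by unfold parity; omega)
        (by unfold parity; omega)
    have g2 : parity (c.y + c.z) ^ 2 ≤ (y + z) ^ 2 :=
      sq_le_sq_of_parity (by unfold parity; push_cast; omega) (by unfold parity; omega)
        (by unfold parity; omega)
    have g3 : parity c.x ^ 2 ≤ x ^ 2 := sq_le_sq_of_parity (by omega) (by omega) (by omega)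
    have g4 : parity c.y ^ 2 ≤ y ^ 2 := sq_le_sq_of_parity (by omega) (by omega) (by omega)
    have pyz := parity_eq (c.y + c.z)
    have pxz := parity_eq (c.x + c.z + 1)
    rcases px with h | h <;> rcases py with h' | h' <;> rcases pz with h'' | h'' <;>
      rcases pyz with h3 | h3 <;> rcases pxz with h4 | h4 <;> rw [h4.2] at g1 <;>
      rw [h3.2] at g2 <;> rw [h.2] at g3 <;> rw [h'.2] at g4 <;> rw [h.2, h'.2, h''.2] <;> first | omega | linarith
  unfold Counts.density density
  linarith

/-- Compared with (2,1), the centre of x − z moves to 2 and that of t to −1, and r changes sign. The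
constant 4 from completing (x − z − 2)² is paid by 4κ; outside the middle layers x = z = 0. -/
theorem density_two_neg_one_le (hc : c.IsLayer κ κ') (hx : Compat x c.x) (hy : Compat y c.y)
    (hs : Compat s c.s) (hz : Compat z c.z) (ht : Compat t c.t) :
    density 2 (-1) x y s r z t - 4 * κ ≤ c.density 2 1 parity parity := by
  have hr := Int.le_self_sq (-r)
  have hr' : parity c.r ^ 2 = parity c.r := by rcases parity_eq c.r with h | h <;> simp [h.2]
  have px := parity_eq c.x
  have py := parity_eq c.y
  have ps := parity_eq c.s
  have pz := parity_eq c.z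
  have pt := parity_eq c.t
  unfold Compat at *
  have h1 : (parity c.x - parity c.z) ^ 2 ≤ (x - z) ^ 2 - 4 * (x - z) + 4 * κ := by
    have h : (parity c.x - parity c.z) ^ 2 ≤ (x - z - 2) ^ 2 :=
      sq_le_sq_of_parity (by omega) (by omega) (by omega)
    rcases hc with hc | hc | hc
    · rw [hx.2 (by omega), hz.2 (by omega), hc.1, hc.2.2.2.1, hc.2.2.2.2.1]; simp [parity_zero]
    · rw [hc.2.2.2.1]; linarith
    · rw [hx.2 (by omega), hz.2 (by omega), hc.1, hc.2.2.2.1, hc.2.2.2.2.2.1]; simp [parity_zero]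
  have h2 : (parity c.y + parity c.z - 1) ^ 2 ≤ (y + z - 1) ^ 2 :=
    sq_le_sq_of_parity (by omega) (by omega) (by omega)
  have h3 : (parity c.x - 1) ^ 2 ≤ (x - 1) ^ 2 :=
    sq_le_sq_of_parity (by omega) (by omega) (by omega)
  have h4 : (parity c.y - 1) ^ 2 ≤ (y - 1) ^ 2 :=
    sq_le_sq_of_parity (by omega) (by omega) (by omega)
  have h5 : (parity c.s - 1) ^ 2 ≤ (s - 1) ^ 2 :=
    sq_le_sq_of_parity (by omega) (by omega) (by omega)
  have h6 : (parity c.s + parity c.t - 1) ^ 2 ≤ (s + t - 1) ^ 2 :=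
    sq_le_sq_of_parity (by omega) (by omega) (by omega)
  have h7 : (parity c.t - 1) ^ 2 ≤ (t + 1) ^ 2 :=
    sq_le_sq_of_parity (by omega) (by omega) (by omega)
  unfold Counts.density density
  linarith

/-- Here the centres are x − z = −2 and x = y = s = −1, the others as for (2,1). On low layers 6r −
2r² ≤ 4 for integers r, which is the 4κ'. -/
theorem density_zero_three_le (hc : c.IsLayer κ κ') (hx : Compat x c.x) (hy : Compat y c.y)
    (hs : Compat s c.s) (hr : Compat r c.r) (hz : Compat z c.z) (ht : Compat t c.t) :
    density 0 3 x y s r z t - 4 * κ - 4 * κ' ≤ c.density 2 1 parity parity := by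
  have hr' : parity c.r ^ 2 = parity c.r := by rcases parity_eq c.r with h | h <;> simp [h.2]
  have px := parity_eq c.x
  have py := parity_eq c.y
  have ps := parity_eq c.s
  have pz := parity_eq c.z
  have pt := parity_eq c.t
  unfold Compat at *
  have h0 : 6 * r - 2 * r ^ 2 - 4 * κ' ≤ 0 := by
    rcases hc with hc | hc | hc
    · rw [hr.2 (by omega)]; omega
    · rw [hr.2 (by omega)]; omega
    · rw [hc.2.2.2.2.2.2]
      have := Int.le_self_sq (r - 1)
      linarith
  have h1 : (parity c.x - parity c.z) ^ 2 ≤ (x - z) ^ 2 + 4 * (x - z) + 4 * κ := by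
    have h : (parity c.x - parity c.z) ^ 2 ≤ (x - z + 2) ^ 2 :=
      sq_le_sq_of_parity (by omega) (by omega) (by omega)
    rcases hc with hc | hc | hc
    · rw [hx.2 (by omega), hz.2 (by omega), hc.1, hc.2.2.2.1, hc.2.2.2.2.1]; simp [parity_zero]
    · rw [hc.2.2.2.1]; linarith
    · rw [hx.2 (by omega), hz.2 (by omega), hc.1, hc.2.2.2.1, hc.2.2.2.2.2.1]; simp [parity_zero]
  have h2 : (parity c.y + parity c.z - 1) ^ 2 ≤ (y + z - 1) ^ 2 :=
    sq_le_sq_of_parity (by omega) (by omega) (by omega)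
  have h3 : (parity c.x - 1) ^ 2 ≤ (x + 1) ^ 2 :=
    sq_le_sq_of_parity (by omega) (by omega) (by omega)
  have h4 : (parity c.y - 1) ^ 2 ≤ (y + 1) ^ 2 :=
    sq_le_sq_of_parity (by omega) (by omega) (by omega)
  have h5 : (parity c.s - 1) ^ 2 ≤ (s + 1) ^ 2 :=
    sq_le_sq_of_parity (by omega) (by omega) (by omega)
  have h6 : (parity c.s + parity c.t - 1) ^ 2 ≤ (s + t - 1) ^ 2 :=
    sq_le_sq_of_parity (by omega) (by omega) (by omega)
  have h7 : (parity c.t - 1) ^ 2 ≤ (t - 1) ^ 2 :=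
    sq_le_sq_of_parity (by omega) (by omega) (by omega)
  unfold Counts.density density
  linarith

/-- Negating the KdV sums matches the completed squares of (0,1) with those of (2,1) except where
they interact; the excluded parities are exactly those at which value is lost. -/
theorem density_le_of_not_bad (hb : ¬c.Bad) :
    c.density 2 1 parity parity ≤ c.density 0 1 (fun n => -parity n) parity := by
  unfold Counts.Bad at hb
  have px := parity_eq c.x
  have py := parity_eq c.y
  have ps := parity_eq c.s
  have pr := parity_eq c.r
  have pz := parity_eq c.z
  have pt := parity_eq c.t
  have hs : parity c.s = 0 := by omega
  have ht : parity c.t = 0 := by omega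
  unfold Counts.density density
  simp only [hs, ht]
  rcases px with hx | hx <;> rcases py with hy | hy <;> rcases pz with hz | hz <;>
    rcases pr with hr | hr <;> first | (exfalso; omega) | simp [hx.2, hy.2, hz.2, hr.2]

/-- The path `0, 1, 0, 1, …` up to the odd index `n`, then `1, 2, 1, 2, …`. -/
def riseAt (n k : ℕ) : ℤ := if k ≤ n then parity k else 2 - parity k

/-- The path `0, 1, 0, 1, …` up to the even index `n`, then `0, -1, 0, -1, …`. -/
def fallAt (n k : ℕ) : ℤ := if k ≤ n then parity k else -parity k

theorem riseAt_of_le {n k : ℕ} (h : k ≤ n) : riseAt n k = parity k := if_pos h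

theorem riseAt_of_ge {n k : ℕ} (hn : n % 2 = 1) (h : n ≤ k) : riseAt n k = 2 - parity k := by
  unfold riseAt
  split_ifs with h'
  · have := parity_eq k
    omega
  · rfl

theorem fallAt_of_le {n k : ℕ} (h : k ≤ n) : fallAt n k = parity k := if_pos h

theorem fallAt_of_ge {n k : ℕ} (hn : n % 2 = 0) (h : n ≤ k) : fallAt n k = -parity k := by
  unfold fallAt
  split_ifs with h'
  · have := parity_eq k
    omega
  · rfl

theorem isPath_parity : IsPath parity := by
  refine ⟨rfl, fun k => ?_⟩
  unfold parity
  omega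

theorem isPath_riseAt {n : ℕ} (hn : n % 2 = 1) : IsPath (riseAt n) := by
  refine ⟨by simp [riseAt, parity], fun k => ?_⟩
  unfold riseAt parity
  split_ifs <;> omega

theorem isPath_fallAt {n : ℕ} (hn : n % 2 = 0) : IsPath (fallAt n) := by
  refine ⟨by simp [fallAt, parity], fun k => ?_⟩
  unfold fallAt parity
  split_ifs <;> omega

/-- The position of a layer relative to a pivot of KdV type. -/
def Counts.PivotK (n m : ℕ) (c : Counts) (κ κ' : ℤ) : Prop :=
  (c.x = 0 ∧ c.y = 0 ∧ c.r = 0 ∧ c.z = 0 ∧ κ = 0 ∧ κ' = 0 ∧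
    ((c.s ≤ n ∧ c.t ≤ m ∧ ¬c.Bad) ∨ (n ≤ c.s ∧ m ≤ c.t))) ∨
  (c.s = 0 ∧ c.r = 0 ∧ c.t = 0 ∧ κ = 1 ∧ κ' = 0 ∧ n ≤ c.x ∧
    ((c.y ≤ n ∧ c.z ≤ m ∧ ¬c.Bad) ∨ (n ≤ c.y ∧ m ≤ c.z))) ∨
  (c.x = 0 ∧ c.y = 0 ∧ c.s = 0 ∧ c.z = 0 ∧ c.t = 0 ∧ κ = 0 ∧ κ' = 1 ∧ m ≤ c.r)

/-- The position of a layer relative to a pivot of Toda type. -/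
def Counts.PivotT (n m : ℕ) (c : Counts) (κ κ' : ℤ) : Prop :=
  (c.x = 0 ∧ c.y = 0 ∧ c.r = 0 ∧ c.z = 0 ∧ κ = 0 ∧ κ' = 0 ∧ c.s ≤ n ∧
    ((c.t ≤ m ∧ ¬c.Bad) ∨ m ≤ c.t)) ∨
  (c.s = 0 ∧ c.r = 0 ∧ c.t = 0 ∧ κ = 1 ∧ κ' = 0 ∧ c.y ≤ n ∧
    ((n ≤ c.x ∧ c.z ≤ m ∧ ¬c.Bad) ∨ (c.x ≤ n ∧ m ≤ c.z))) ∨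
  (c.x = 0 ∧ c.y = 0 ∧ c.s = 0 ∧ c.z = 0 ∧ c.t = 0 ∧ κ = 0 ∧ κ' = 1 ∧ m ≤ c.r)

/-- The substitution (2 − ·) on KdV sums and (− ·) on Toda sums carries the (2,1) squares to the
(2,−1) squares exactly, up to 4κ; this covers layers past both switches. Layers where only some sums
have switched agree as well, because they are not bad. -/
theorem density_le_of_pivotK {n m : ℕ} (hn : n % 2 = 1) (hm : m % 2 = 0)
    (hc : c.PivotK n m κ κ') :
    c.density 2 1 parity parity ≤ c.density 2 (-1) (riseAt n) (fallAt m) - 4 * κ := by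
  have hS0 := riseAt_of_le (Nat.zero_le n)
  have hT0 := fallAt_of_le (Nat.zero_le m)
  unfold Counts.PivotK Counts.Bad at hc
  have px := parity_eq c.x
  have py := parity_eq c.y
  have ps := parity_eq c.s
  have pr := parity_eq c.r
  have pz := parity_eq c.z
  have pt := parity_eq c.t
  unfold Counts.density density
  rcases hc with ⟨hx, hy, hr, hz, hκ, hκ', ⟨h1, h2, h3⟩ | ⟨h1, h2⟩⟩ |
    ⟨hs, hr, ht, hκ, hκ', h0, ⟨h1, h2, h3⟩ | ⟨h1, h2⟩⟩ | ⟨hx, hy, hs, hz, ht, hκ, hκ', h0⟩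
  · rw [hx, hy, hr, hz, hκ, riseAt_of_le h1, fallAt_of_le h2, hS0, hT0, parity_zero]
    have e1 : parity c.s = 0 := by omega
    have e2 : parity c.t = 0 := by omega
    simp [e1, e2]
  · rw [hx, hy, hr, hz, hκ, riseAt_of_ge hn h1, fallAt_of_ge hm h2, hS0, hT0, parity_zero]
    rcases ps with hs | hs <;> rcases pt with ht | ht <;> simp [hs.2, ht.2]
  · rw [hs, hr, ht, hκ, riseAt_of_ge hn h0, riseAt_of_le h1, fallAt_of_le h2, hS0, hT0,
      parity_zero]
    rcases px with hx | hx <;> rcases py with hy | hy <;> rcases pz with hz | hz <;>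
      first | (exfalso; omega) | simp [hx.2, hy.2, hz.2]
  · rw [hs, hr, ht, hκ, riseAt_of_ge hn h0, riseAt_of_ge hn h1, fallAt_of_ge hm h2, hS0, hT0,
      parity_zero]
    rcases px with hx | hx <;> rcases py with hy | hy <;> rcases pz with hz | hz <;>
      simp [hx.2, hy.2, hz.2]
  · rw [hx, hy, hs, hz, ht, hκ, fallAt_of_ge hm h0, hS0, hT0, parity_zero]
    rcases pr with hr | hr <;> simp [hr.2]

/-- Now the exact reflection is (− ·) on KdV sums and (2 − ·) on Toda sums, taking (2,1) to (0,3) up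
to 4κ + 4κ'. Where instead x has passed its switch and z has not, x becomes x − 2 and the only
possible loss is from y odd with z even, which is bad. -/
theorem density_le_of_pivotT {n m : ℕ} (hn : n % 2 = 1) (hm : m % 2 = 1)
    (hc : c.PivotT n m κ κ') :
    c.density 2 1 parity parity ≤
      c.density 0 3 (fun k => -riseAt n k) (riseAt m) - 4 * κ - 4 * κ' := by
  have hS0 := riseAt_of_le (Nat.zero_le n)
  have hT0 := riseAt_of_le (Nat.zero_le m)
  unfold Counts.PivotT Counts.Bad at hc
  have px := parity_eq c.x
  have py := parity_eq c.y
  have ps := parity_eq c.s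
  have pr := parity_eq c.r
  have pz := parity_eq c.z
  have pt := parity_eq c.t
  simp only [Counts.density, density]
  rcases hc with ⟨hx, hy, hr, hz, hκ, hκ', h0, ⟨h1, h2⟩ | h1⟩ |
    ⟨hs, hr, ht, hκ, hκ', h0, ⟨h1, h2, h3⟩ | ⟨h1, h2⟩⟩ | ⟨hx, hy, hs, hz, ht, hκ, hκ', h0⟩
  · rw [hx, hy, hr, hz, hκ, hκ', riseAt_of_le h0, riseAt_of_le h1, hS0, hT0, parity_zero]
    have e1 : parity c.s = 0 := by omega
    have e2 : parity c.t = 0 := by omega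
    simp [e1, e2]
  · rw [hx, hy, hr, hz, hκ, hκ', riseAt_of_le h0, riseAt_of_ge hm h1, hS0, hT0, parity_zero]
    rcases ps with hs | hs <;> rcases pt with ht | ht <;> simp [hs.2, ht.2]
  · rw [hs, hr, ht, hκ, hκ', riseAt_of_ge hn h1, riseAt_of_le h0, riseAt_of_le h2, hS0, hT0,
      parity_zero]
    rcases px with hx | hx <;> rcases py with hy | hy <;> rcases pz with hz | hz <;>
      first | (exfalso; omega) | simp [hx.2, hy.2, hz.2]
  · rw [hs, hr, ht, hκ, hκ', riseAt_of_le h1, riseAt_of_le h0, riseAt_of_ge hm h2, hS0, hT0,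
      parity_zero]
    rcases px with hx | hx <;> rcases py with hy | hy <;> rcases pz with hz | hz <;>
      simp [hx.2, hy.2, hz.2]
  · rw [hx, hy, hs, hz, ht, hκ, hκ', riseAt_of_ge hm h0, hS0, hT0, parity_zero]
    rcases pr with hr | hr <;> simp [hr.2]

end Counts

/-! ### Counts as functions of the height, and the highest bad layer -/

section Pivot

variable {ι : Type*} [Fintype ι]

theorem count_le_count (τ : ι → ℤ) (q : ι → ℝ) {f g : ℝ → ℤ}
    (hg : ∀ x, g x = 0 ∨ g x = 1) (h : ∀ i, f (q i) ≤ g (q i)) : count τ q f ≤ count τ q g := by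
  refine Finset.card_le_card fun i hi => ?_
  simp only [Finset.mem_filter, Finset.mem_univ, true_and] at hi ⊢
  refine ⟨hi.1, ?_⟩
  have := h i
  have := hg (q i)
  omega

theorem count_eq_zero (τ : ι → ℤ) (q : ι → ℝ) {f : ℝ → ℤ} (h : ∀ i, f (q i) = 0) :
    count τ q f = 0 := by
  simp [count, h]

theorem count_congr (τ : ι → ℤ) (q : ι → ℝ) {f g : ℝ → ℤ} (h : ∀ i, f (q i) = g (q i)) :
    count τ q f = count τ q g := by
  simp [count, h]

theorem count_le_card (τ : ι → ℤ) (q : ι → ℝ) (f : ℝ → ℤ) : count τ q f ≤ Fintype.card ι :=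
  Finset.card_le_univ _

theorem compat_count (τ : ι → ℤ) (hτ : ∀ i, τ i = 0 ∨ τ i = 1 ∨ τ i = -1) (q : ι → ℝ)
    {f : ℝ → ℤ} (hf : ∀ x, f x = 0 ∨ f x = 1) : Compat (∑ i, τ i * f (q i)) (count τ q f) := by
  refine ⟨sum_threshold_parity τ hτ q hf, fun h => ?_⟩
  rw [sum_threshold τ q hf, Finset.card_eq_zero.mp h, Finset.sum_empty]

variable {δ₁ δ₂ : ℝ}

theorem isThreshold_lowK (u : ℝ) : IsThreshold (lowK δ₁ δ₂ u) where
  mono x y h := cell_le_cell fun h1 h2 => by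
    simp only [max_lt_iff] at *; exact ⟨⟨by linarith, h1.2⟩, h2⟩
  zero_or_one x := cell_zero_or_one _ _ _
  at_zero := cell_eq_zero (by rintro ⟨h1, h2⟩; simp only [max_lt_iff] at h1; linarith [h1.1])

theorem isThreshold_midK (hδ₁ : 0 < δ₁) (u : ℝ) : IsThreshold (midK δ₁ δ₂ u) where
  mono x y h := cell_le_cell fun h1 h2 => by
    simp only [le_min_iff] at *; exact ⟨h1, by linarith, h2.2⟩
  zero_or_one x := cell_zero_or_one _ _ _
  at_zero := cell_eq_zero (by rintro ⟨h1, h2⟩; simp only [le_min_iff] at h2; linarith [h2.1])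

theorem isThreshold_highK (hδ₁ : 0 < δ₁) (u : ℝ) : IsThreshold (highK δ₁ δ₂ u) where
  mono x y h := cell_le_cell fun h1 h2 => ⟨h1, by linarith⟩
  zero_or_one x := cell_zero_or_one _ _ _
  at_zero := cell_eq_zero (by rintro ⟨h1, h2⟩; linarith)

theorem isThreshold_lowT (u : ℝ) : IsThreshold (lowT δ₁ δ₂ u) where
  mono x y h := cell_le_cell fun h1 h2 => by
    simp only [le_min_iff] at *; exact ⟨h1, by linarith, h2.2⟩
  zero_or_one x := cell_zero_or_one _ _ _
  at_zero := cell_eq_zero (by rintro ⟨h1, h2⟩; simp only [le_min_iff] at h2; linarith [h2.1])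

theorem isThreshold_midT (hδ₂ : δ₁ < δ₂) (u : ℝ) : IsThreshold (midT δ₁ δ₂ u) where
  mono x y h := cell_le_cell fun h1 h2 => by
    simp only [le_min_iff] at *; exact ⟨h1, by linarith, h2.2⟩
  zero_or_one x := cell_zero_or_one _ _ _
  at_zero := cell_eq_zero (by rintro ⟨h1, h2⟩; simp only [le_min_iff] at h2; linarith [h2.1])

theorem isThreshold_highT (hδ₂ : 0 < δ₂) (u : ℝ) : IsThreshold (highT δ₂ u) where
  mono x y h := cell_le_cell fun h1 h2 => ⟨h1, by linarith⟩
  zero_or_one x := cell_zero_or_one _ _ _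
  at_zero := cell_eq_zero (by rintro ⟨h1, h2⟩; linarith)

/-- The counts of the layer at height `u`. -/
def countsAt (δ₁ δ₂ : ℝ) (τ : ι → ℤ) (ω p : ι → ℝ) (u : ℝ) : Counts where
  x := count τ ω (lowK δ₁ δ₂ u)
  y := count τ ω (midK δ₁ δ₂ u)
  s := count τ ω (highK δ₁ δ₂ u)
  r := count τ p (lowT δ₁ δ₂ u)
  z := count τ p (midT δ₁ δ₂ u)
  t := count τ p (highT δ₂ u)

theorem cell_eq_zero_of_imp {a b u : ℝ} (h : a < u → b < u) : cell a b u = 0 :=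
  cell_eq_zero fun h' => (h h'.1).not_ge h'.2

section Regions

variable (τ : ι → ℤ) (ω p : ι → ℝ) {u u' : ℝ}

theorem countsAt_of_high (hδ₁ : 0 < δ₁) (hu : δ₂ < u) :
    (countsAt δ₁ δ₂ τ ω p u).x = 0 ∧ (countsAt δ₁ δ₂ τ ω p u).y = 0 ∧
      (countsAt δ₁ δ₂ τ ω p u).r = 0 ∧ (countsAt δ₁ δ₂ τ ω p u).z = 0 ∧
      cell (δ₂ - δ₁) δ₂ u = 0 ∧ cell 0 (δ₂ - δ₁) u = 0 := by
  refine ⟨count_eq_zero _ _ fun _ => cell_eq_zero_of_imp fun _ => hu,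
    count_eq_zero _ _ fun _ => cell_eq_zero_of_imp fun _ => min_lt_of_right_lt hu,
    count_eq_zero _ _ fun _ => cell_eq_zero_of_imp fun _ => min_lt_of_right_lt (by linarith),
    count_eq_zero _ _ fun _ => cell_eq_zero_of_imp fun _ => min_lt_of_right_lt hu,
    cell_eq_zero fun h => by linarith [h.2], cell_eq_zero fun h => by linarith [h.2]⟩

theorem countsAt_of_mid (hu : δ₂ - δ₁ < u) (hu' : u ≤ δ₂) :
    (countsAt δ₁ δ₂ τ ω p u).s = 0 ∧ (countsAt δ₁ δ₂ τ ω p u).r = 0 ∧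
      (countsAt δ₁ δ₂ τ ω p u).t = 0 ∧ cell (δ₂ - δ₁) δ₂ u = 1 ∧ cell 0 (δ₂ - δ₁) u = 0 := by
  refine ⟨count_eq_zero _ _ fun _ => cell_eq_zero_of_imp fun h => absurd h hu'.not_gt,
    count_eq_zero _ _ fun _ => cell_eq_zero_of_imp fun _ => min_lt_of_right_lt hu,
    count_eq_zero _ _ fun _ => cell_eq_zero_of_imp fun h => absurd h hu'.not_gt,
    cell_eq_one hu hu', cell_eq_zero fun h => by linarith [h.2]⟩

theorem countsAt_of_low (hδ₁ : 0 < δ₁) (hu : u ≤ δ₂ - δ₁) :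
    (countsAt δ₁ δ₂ τ ω p u).x = 0 ∧ (countsAt δ₁ δ₂ τ ω p u).y = 0 ∧
      (countsAt δ₁ δ₂ τ ω p u).s = 0 ∧ (countsAt δ₁ δ₂ τ ω p u).z = 0 ∧
      (countsAt δ₁ δ₂ τ ω p u).t = 0 ∧ cell (δ₂ - δ₁) δ₂ u = 0 := by
  refine ⟨count_eq_zero _ _ fun _ => cell_eq_zero_of_imp fun h => absurd (max_lt_iff.mp h).2 hu.not_gt,
    count_eq_zero _ _ fun _ => cell_eq_zero_of_imp fun h => absurd h hu.not_gt,
    count_eq_zero _ _ fun _ => cell_eq_zero_of_imp fun h => by linarith,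
    count_eq_zero _ _ fun _ => cell_eq_zero_of_imp fun h => absurd h hu.not_gt,
    count_eq_zero _ _ fun _ => cell_eq_zero_of_imp fun h => by linarith,
    cell_eq_zero fun h => by linarith [h.1]⟩

theorem countsAt_of_nonpos (hu : u ≤ 0) :
    (countsAt δ₁ δ₂ τ ω p u).r = 0 ∧ cell 0 (δ₂ - δ₁) u = 0 :=
  ⟨count_eq_zero _ _ fun _ => cell_eq_zero_of_imp fun h => absurd h hu.not_gt,
    cell_eq_zero fun h => by linarith [h.1]⟩

theorem countsAt_isLayer (hδ₁ : 0 < δ₁) :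
    (countsAt δ₁ δ₂ τ ω p u).IsLayer (cell (δ₂ - δ₁) δ₂ u) (cell 0 (δ₂ - δ₁) u) := by
  rcases lt_or_ge δ₂ u with h | h
  · exact Or.inl (countsAt_of_high τ ω p hδ₁ h)
  rcases lt_or_ge (δ₂ - δ₁) u with h' | h'
  · exact Or.inr (Or.inl (countsAt_of_mid τ ω p h' h))
  obtain ⟨h1, h2, h3, h4, h5, h6⟩ := countsAt_of_low τ ω p hδ₁ h'
  rcases le_or_gt u 0 with h0 | h0
  · obtain ⟨h7, h8⟩ := countsAt_of_nonpos (δ₁ := δ₁) (δ₂ := δ₂) τ ω p h0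
    exact Or.inl ⟨h1, h2, h7, h4, h6, h8⟩
  · exact Or.inr (Or.inr ⟨h1, h2, h3, h4, h5, h6, cell_eq_one h0 h'⟩)

theorem countsAt_mid_mono (hu : δ₂ - δ₁ < u) (huu : u ≤ u') (hu' : u' ≤ δ₂) :
    (countsAt δ₁ δ₂ τ ω p u).x ≤ (countsAt δ₁ δ₂ τ ω p u').x ∧
      (countsAt δ₁ δ₂ τ ω p u').y ≤ (countsAt δ₁ δ₂ τ ω p u).y ∧
      (countsAt δ₁ δ₂ τ ω p u').z ≤ (countsAt δ₁ δ₂ τ ω p u).z := by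
  refine ⟨count_le_count _ _ (fun _ => cell_zero_or_one _ _ _) fun _ => cell_le_cell
      fun h1 h2 => ⟨h1.trans_le huu, hu'⟩,
    count_le_count _ _ (fun _ => cell_zero_or_one _ _ _) fun _ => cell_le_cell
      fun _ h2 => ⟨hu, huu.trans h2⟩,
    count_le_count _ _ (fun _ => cell_zero_or_one _ _ _) fun _ => cell_le_cell
      fun _ h2 => ⟨hu, huu.trans h2⟩⟩

theorem countsAt_y_le_x (hu' : δ₂ - δ₁ < u') (hu'' : u' ≤ δ₂) :
    (countsAt δ₁ δ₂ τ ω p u).y ≤ (countsAt δ₁ δ₂ τ ω p u').x :=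
  count_le_count _ _ (fun _ => cell_zero_or_one _ _ _) fun _ => cell_le_cell
      fun h1 h2 =>
    ⟨max_lt (by linarith [(le_min_iff.mp h2).1]) hu', hu''⟩

theorem countsAt_high_mono (hu : δ₂ < u) (huu : u ≤ u') :
    (countsAt δ₁ δ₂ τ ω p u').s ≤ (countsAt δ₁ δ₂ τ ω p u).s ∧
      (countsAt δ₁ δ₂ τ ω p u').t ≤ (countsAt δ₁ δ₂ τ ω p u).t :=
  ⟨count_le_count _ _ (fun _ => cell_zero_or_one _ _ _) fun _ => cell_le_cell
      fun _ h2 => ⟨hu, huu.trans h2⟩,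
    count_le_count _ _ (fun _ => cell_zero_or_one _ _ _) fun _ => cell_le_cell
      fun _ h2 => ⟨hu, huu.trans h2⟩⟩

theorem countsAt_high_le_mid (hδ₁ : 0 < δ₁) (hu' : δ₂ - δ₁ < u') (hu'' : u' ≤ δ₂) :
    (countsAt δ₁ δ₂ τ ω p u).s ≤ (countsAt δ₁ δ₂ τ ω p u').x ∧
      (countsAt δ₁ δ₂ τ ω p u).s ≤ (countsAt δ₁ δ₂ τ ω p u').y ∧
      (countsAt δ₁ δ₂ τ ω p u).t ≤ (countsAt δ₁ δ₂ τ ω p u').z :=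
  ⟨count_le_count _ _ (fun _ => cell_zero_or_one _ _ _) fun _ => cell_le_cell
      fun h1 h2 => ⟨max_lt (by linarith) hu', hu''⟩,
    count_le_count _ _ (fun _ => cell_zero_or_one _ _ _) fun _ => cell_le_cell
      fun h1 h2 => ⟨hu', le_min (by linarith) hu''⟩,
    count_le_count _ _ (fun _ => cell_zero_or_one _ _ _) fun _ => cell_le_cell
      fun h1 h2 => ⟨hu', le_min (by linarith) hu''⟩⟩

theorem countsAt_le_low (hδ₁ : 0 < δ₁) (hu0 : 0 < u') (hu' : u' ≤ δ₂ - δ₁) :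
    (countsAt δ₁ δ₂ τ ω p u).z ≤ (countsAt δ₁ δ₂ τ ω p u').r ∧
      (countsAt δ₁ δ₂ τ ω p u).t ≤ (countsAt δ₁ δ₂ τ ω p u').r :=
  ⟨count_le_count _ _ (fun _ => cell_zero_or_one _ _ _) fun _ => cell_le_cell
      fun h1 h2 =>
      ⟨hu0, le_min (by linarith [(le_min_iff.mp h2).1]) hu'⟩,
    count_le_count _ _ (fun _ => cell_zero_or_one _ _ _) fun _ => cell_le_cell
      fun h1 h2 => ⟨hu0, le_min (by linarith) hu'⟩⟩

theorem countsAt_eventually_eq (s : ℝ) :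
    ∀ᶠ u in nhdsWithin s (Set.Iic s), countsAt δ₁ δ₂ τ ω p u = countsAt δ₁ δ₂ τ ω p s := by
  have h : ∀ (q : ι → ℝ) (a b : ℝ → ℝ), ∀ᶠ u in nhdsWithin s (Set.Iic s),
      count τ q (fun v => cell (a v) (b v) u) = count τ q (fun v => cell (a v) (b v) s) := by
    intro q a b
    have : ∀ᶠ u in nhdsWithin s (Set.Iic s), ∀ i,
        cell (a (q i)) (b (q i)) u = cell (a (q i)) (b (q i)) s :=
      Filter.eventually_all.mpr fun i => cell_eventually_eq _ _ _
    filter_upwards [this] with u hu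
    exact count_congr τ q hu
  filter_upwards [h ω (fun v => max (δ₂ - v) (δ₂ - δ₁)) (fun _ => δ₂),
    h ω (fun _ => δ₂ - δ₁) (fun v => min (δ₂ - 2 * δ₁ + v) δ₂),
    h ω (fun _ => δ₂) (fun v => δ₂ + (v - 2 * δ₁) / 2),
    h p (fun _ => 0) (fun v => min v (δ₂ - δ₁)), h p (fun _ => δ₂ - δ₁) (fun v => min v δ₂),
    h p (fun _ => δ₂) (fun v => v)] with u h1 h2 h3 h4 h5 h6
  exact Counts.mk.injEq .. |>.mpr ⟨h1, h2, h3, h4, h5, h6⟩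

/-- Above every level all counts vanish, so bad heights are bounded; left continuity of the counts
puts their supremum among them. -/
theorem exists_last_bad (hδ₁ : 0 < δ₁) (hδ₂ : δ₁ < δ₂) (hω : ∀ i, 0 ≤ ω i)
    (hp : ∀ i, 0 ≤ p i) (hb : ∃ u, (countsAt δ₁ δ₂ τ ω p u).Bad) :
    ∃ u, (countsAt δ₁ δ₂ τ ω p u).Bad ∧ ∀ u', u < u' → ¬(countsAt δ₁ δ₂ τ ω p u').Bad := by
  let K : Set ℝ := {u | (countsAt δ₁ δ₂ τ ω p u).Bad}
  have hK : BddAbove K := by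
    -- Each single ω i or p i is at most the total sum, so no level reaches beyond this height.
    refine ⟨max δ₂ (δ₂ + ∑ i, (ω i + p i)), fun u hu => ?_⟩
    by_contra! h
    obtain ⟨h1, h2⟩ := max_lt_iff.mp h
    obtain ⟨hx, hy, -, hz, -, -⟩ := countsAt_of_high τ ω p hδ₁ h1
    have hle : ∀ i, ω i + p i ≤ ∑ i, (ω i + p i) := fun i =>
      Finset.single_le_sum (f := fun i => ω i + p i) (fun i _ => add_nonneg (hω i) (hp i))
        (Finset.mem_univ i)
    have hs : (countsAt δ₁ δ₂ τ ω p u).s = 0 := count_eq_zero _ _ fun i => cell_eq_zero fun h => by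
      linarith [h.2, hle i, hω i, hp i]
    have ht : (countsAt δ₁ δ₂ τ ω p u).t = 0 := count_eq_zero _ _ fun i => cell_eq_zero fun h => by
      linarith [h.2, hle i, hω i, hp i]
    have hu' : (countsAt δ₁ δ₂ τ ω p u).Bad := hu
    unfold Counts.Bad at hu'
    omega
  have hlub := isLUB_csSup (s := K) hb hK
  obtain ⟨u, hu, hu'⟩ :=
    ((hlub.frequently_mem hb).and_eventually (countsAt_eventually_eq τ ω p (sSup K))).exists
  refine ⟨sSup K, ?_, fun u' h h' => h.not_ge (hlub.1 h')⟩
  rw [← hu']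
  exact hu

end Regions

end Pivot

/-! ### Comparison of total energies in different directions -/

section Spins

variable {ι : Type*} [Fintype ι] {δ₁ δ₂ : ℝ} {ω p : ι → ℝ}

/-- The energy of the spins `τ` along the direction `(a, b)`. -/
def layerEnergy (δ₁ δ₂ : ℝ) (ω p : ι → ℝ) (a b : ℤ) (τ : ι → ℤ) : ℝ :=
  spinEnergy (fun i => field δ₁ δ₂ a b (ω i) (p i))
    (fun i j => coupling δ₁ δ₂ (ω i) (p i) (ω j) (p j)) τ

/-- The density of the spins `τ` at height `u`. -/
def densityAt (δ₁ δ₂ : ℝ) (ω p : ι → ℝ) (a b : ℤ) (τ : ι → ℤ) (u : ℝ) : ℤ :=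
  density a b (∑ i, τ i * lowK δ₁ δ₂ u (ω i)) (∑ i, τ i * midK δ₁ δ₂ u (ω i))
    (∑ i, τ i * highK δ₁ δ₂ u (ω i)) (∑ i, τ i * lowT δ₁ δ₂ u (p i))
    (∑ i, τ i * midT δ₁ δ₂ u (p i)) (∑ i, τ i * highT δ₂ u (p i))

/-- Integration of a layerwise bound. The middle and low layers have lengths δ₁ and δ₂ − δ₁, so k =
4 alone yields 4δ₁ and k = k' = 4 yields 4δ₂. -/
theorem layerEnergy_le (hδ₁ : 0 < δ₁) (hδ₂ : δ₁ < δ₂) (hω : ∀ i, 0 ≤ ω i) (hp : ∀ i, 0 ≤ p i)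
    {a b a' b' k k' : ℤ} {τ τ' : ι → ℤ}
    (h : ∀ u, densityAt δ₁ δ₂ ω p a b τ u ≤ densityAt δ₁ δ₂ ω p a' b' τ' u +
      k * cell (δ₂ - δ₁) δ₂ u + k' * cell 0 (δ₂ - δ₁) u) :
    layerEnergy δ₁ δ₂ ω p a b τ ≤
      layerEnergy δ₁ δ₂ ω p a' b' τ' + k * δ₁ + k' * (δ₂ - δ₁) := by
  have h1 := hasInt_density hδ₁ hδ₂ a b hω hp τ
  have h2 := ((hasInt_density hδ₁ hδ₂ a' b' hω hp τ').add
    ((hasInt_cell (δ₂ - δ₁) δ₂).const_mul (k : ℝ))).add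
    ((hasInt_cell 0 (δ₂ - δ₁)).const_mul (k' : ℝ))
  have h3 := h1.mono h2 fun u => by exact_mod_cast h u
  rw [max_eq_left (by linarith), max_eq_left (by linarith)] at h3
  calc layerEnergy δ₁ δ₂ ω p a b τ ≤ _ := h3
    _ = _ := by rw [layerEnergy]; ring

theorem exists_densityAt_eq [DecidableEq ι] (hδ₁ : 0 < δ₁) (hδ₂ : δ₁ < δ₂)
    (hωp : ∀ i, ω i = 0 ∨ p i = 0) {τ : ι → ℤ} (hτ : ∀ i, τ i = 0 ∨ τ i = 1 ∨ τ i = -1)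
    {gS gT : ℕ → ℤ} (hS : IsPath gS) (hT : IsPath gT) :
    ∃ τ' : ι → ℤ, (∀ i, τ' i = τ i ∨ τ' i = -τ i) ∧ ∀ a b u,
      densityAt δ₁ δ₂ ω p a b τ' u = (countsAt δ₁ δ₂ τ ω p u).density a b gS gT := by
  obtain ⟨τ', h, hS', hT'⟩ := exists_spins_of_paths τ hτ ω p hωp gS gT hS hT
  refine ⟨τ', h, fun a b u => ?_⟩
  rw [densityAt, hS' _ (isThreshold_lowK u), hS' _ (isThreshold_midK hδ₁ u),
    hS' _ (isThreshold_highK hδ₁ u), hT' _ (isThreshold_lowT u), hT' _ (isThreshold_midT hδ₂ u),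
    hT' _ (isThreshold_highT (hδ₁.trans hδ₂) u)]
  rfl

theorem densityAt_compat (τ : ι → ℤ) (hτ : ∀ i, τ i = 0 ∨ τ i = 1 ∨ τ i = -1) (u : ℝ) :
    let c := countsAt δ₁ δ₂ τ ω p u
    Compat (∑ i, τ i * lowK δ₁ δ₂ u (ω i)) c.x ∧ Compat (∑ i, τ i * midK δ₁ δ₂ u (ω i)) c.y ∧
    Compat (∑ i, τ i * highK δ₁ δ₂ u (ω i)) c.s ∧ Compat (∑ i, τ i * lowT δ₁ δ₂ u (p i)) c.r ∧
    Compat (∑ i, τ i * midT δ₁ δ₂ u (p i)) c.z ∧ Compat (∑ i, τ i * highT δ₂ u (p i)) c.t :=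
  ⟨compat_count τ hτ ω fun _ => cell_zero_or_one _ _ _,
    compat_count τ hτ ω fun _ => cell_zero_or_one _ _ _,
    compat_count τ hτ ω fun _ => cell_zero_or_one _ _ _,
    compat_count τ hτ p fun _ => cell_zero_or_one _ _ _,
    compat_count τ hτ p fun _ => cell_zero_or_one _ _ _,
    compat_count τ hτ p fun _ => cell_zero_or_one _ _ _⟩

theorem densityAt_two_one_le {τ : ι → ℤ} (hτ : ∀ i, τ i = 0 ∨ τ i = 1 ∨ τ i = -1) (u : ℝ) :
    densityAt δ₁ δ₂ ω p 2 1 τ u ≤ (countsAt δ₁ δ₂ τ ω p u).density 2 1 parity parity := by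
  obtain ⟨hx, hy, hs, hr, hz, ht⟩ := densityAt_compat (δ₁ := δ₁) (δ₂ := δ₂) (ω := ω) (p := p) τ hτ u
  exact density_two_one_le hx hy hs hz ht

variable [DecidableEq ι]

theorem exists_layerEnergy_two_one_ge (hδ₁ : 0 < δ₁) (hδ₂ : δ₁ < δ₂) (hω : ∀ i, 0 ≤ ω i)
    (hp : ∀ i, 0 ≤ p i) (hωp : ∀ i, ω i = 0 ∨ p i = 0) {τ : ι → ℤ}
    (hτ : ∀ i, τ i = 0 ∨ τ i = 1 ∨ τ i = -1) :
    ∃ τ' : ι → ℤ, (∀ i, τ' i = τ i ∨ τ' i = -τ i) ∧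
      layerEnergy δ₁ δ₂ ω p 0 1 τ ≤ layerEnergy δ₁ δ₂ ω p 2 1 τ' ∧
      layerEnergy δ₁ δ₂ ω p 2 (-1) τ ≤ layerEnergy δ₁ δ₂ ω p 2 1 τ' + 4 * δ₁ ∧
      layerEnergy δ₁ δ₂ ω p 0 3 τ ≤ layerEnergy δ₁ δ₂ ω p 2 1 τ' + 4 * δ₂ := by
  obtain ⟨τ', h, hd⟩ := exists_densityAt_eq hδ₁ hδ₂ hωp hτ isPath_parity isPath_parity
  refine ⟨τ', h, ?_, ?_, ?_⟩
  · refine (layerEnergy_le hδ₁ hδ₂ hω hp (k := 0) (k' := 0) fun u => ?_).trans_eq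
      (by push_cast; ring)
    obtain ⟨hx, hy, hs, hr, hz, ht⟩ := densityAt_compat (δ₁ := δ₁) (δ₂ := δ₂) (ω := ω) (p := p) τ hτ u
    rw [hd]
    have := density_zero_one_le (r := ∑ i, τ i * lowT δ₁ δ₂ u (p i))
      (s := ∑ i, τ i * highK δ₁ δ₂ u (ω i)) hx hy hz ht
    rw [densityAt]
    linarith
  · refine (layerEnergy_le hδ₁ hδ₂ hω hp (k := 4) (k' := 0) fun u => ?_).trans_eq
      (by push_cast; ring)
    obtain ⟨hx, hy, hs, hr, hz, ht⟩ := densityAt_compat (δ₁ := δ₁) (δ₂ := δ₂) (ω := ω) (p := p) τ hτ u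
    rw [hd]
    have := density_two_neg_one_le (r := ∑ i, τ i * lowT δ₁ δ₂ u (p i))
      (countsAt_isLayer τ ω p hδ₁) hx hy hs hz ht
    rw [densityAt]
    linarith
  · refine (layerEnergy_le hδ₁ hδ₂ hω hp (k := 4) (k' := 4) fun u => ?_).trans_eq
      (by push_cast; ring)
    obtain ⟨hx, hy, hs, hr, hz, ht⟩ := densityAt_compat (δ₁ := δ₁) (δ₂ := δ₂) (ω := ω) (p := p) τ hτ u
    rw [hd]
    have := density_zero_three_le (countsAt_isLayer τ ω p hδ₁) hx hy hs hr hz ht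
    rw [densityAt]
    linarith

theorem exists_layerEnergy_of_pivotK (hδ₁ : 0 < δ₁) (hδ₂ : δ₁ < δ₂) (hω : ∀ i, 0 ≤ ω i)
    (hp : ∀ i, 0 ≤ p i) (hωp : ∀ i, ω i = 0 ∨ p i = 0) {τ : ι → ℤ}
    (hτ : ∀ i, τ i = 0 ∨ τ i = 1 ∨ τ i = -1) {n m : ℕ} (hn : n % 2 = 1) (hm : m % 2 = 0)
    (h : ∀ u, (countsAt δ₁ δ₂ τ ω p u).PivotK n m (cell (δ₂ - δ₁) δ₂ u) (cell 0 (δ₂ - δ₁) u)) :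
    ∃ τ' : ι → ℤ, (∀ i, τ' i = τ i ∨ τ' i = -τ i) ∧
      layerEnergy δ₁ δ₂ ω p 2 1 τ ≤ layerEnergy δ₁ δ₂ ω p 2 (-1) τ' - 4 * δ₁ := by
  obtain ⟨τ', h', hd⟩ := exists_densityAt_eq hδ₁ hδ₂ hωp hτ (isPath_riseAt hn) (isPath_fallAt hm)
  refine ⟨τ', h', ?_⟩
  refine (layerEnergy_le hδ₁ hδ₂ hω hp (k := -4) (k' := 0) fun u => ?_).trans_eq
    (by push_cast; ring)
  rw [hd]
  have h1 := densityAt_two_one_le (δ₁ := δ₁) (δ₂ := δ₂) (ω := ω) (p := p) hτ u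
  have h2 := density_le_of_pivotK hn hm (h u)
  linarith

theorem exists_layerEnergy_of_pivotT (hδ₁ : 0 < δ₁) (hδ₂ : δ₁ < δ₂) (hω : ∀ i, 0 ≤ ω i)
    (hp : ∀ i, 0 ≤ p i) (hωp : ∀ i, ω i = 0 ∨ p i = 0) {τ : ι → ℤ}
    (hτ : ∀ i, τ i = 0 ∨ τ i = 1 ∨ τ i = -1) {n m : ℕ} (hn : n % 2 = 1) (hm : m % 2 = 1)
    (h : ∀ u, (countsAt δ₁ δ₂ τ ω p u).PivotT n m (cell (δ₂ - δ₁) δ₂ u) (cell 0 (δ₂ - δ₁) u)) :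
    ∃ τ' : ι → ℤ, (∀ i, τ' i = τ i ∨ τ' i = -τ i) ∧
      layerEnergy δ₁ δ₂ ω p 2 1 τ ≤ layerEnergy δ₁ δ₂ ω p 0 3 τ' - 4 * δ₂ := by
  obtain ⟨τ', h', hd⟩ := exists_densityAt_eq hδ₁ hδ₂ hωp hτ (isPath_riseAt hn |>.neg)
    (isPath_riseAt hm)
  refine ⟨τ', h', ?_⟩
  refine (layerEnergy_le hδ₁ hδ₂ hω hp (k := -4) (k' := -4) fun u => ?_).trans_eq
    (by push_cast; ring)
  rw [hd]
  have h1 := densityAt_two_one_le (δ₁ := δ₁) (δ₂ := δ₂) (ω := ω) (p := p) hτ u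
  have h2 := density_le_of_pivotT hn hm (h u)
  linarith

/-- The counts at the highest bad layer serve as switching indices. Monotonicity of the counts in u
puts lower layers where the reflection is exact; layers above it are not bad, so partial switching
costs nothing there. Its parities decide between the KdV pivot, direction (2,−1), and the Toda
pivot, direction (0,3). -/
theorem exists_layerEnergy_two_one_le (hδ₁ : 0 < δ₁) (hδ₂ : δ₁ < δ₂) (hω : ∀ i, 0 ≤ ω i)
    (hp : ∀ i, 0 ≤ p i) (hωp : ∀ i, ω i = 0 ∨ p i = 0) {τ : ι → ℤ}
    (hτ : ∀ i, τ i = 0 ∨ τ i = 1 ∨ τ i = -1) :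
    ∃ τ' : ι → ℤ, (∀ i, τ' i = τ i ∨ τ' i = -τ i) ∧
      (layerEnergy δ₁ δ₂ ω p 2 1 τ ≤ layerEnergy δ₁ δ₂ ω p 0 1 τ' ∨
      layerEnergy δ₁ δ₂ ω p 2 1 τ ≤ layerEnergy δ₁ δ₂ ω p 2 (-1) τ' - 4 * δ₁ ∨
      layerEnergy δ₁ δ₂ ω p 2 1 τ ≤ layerEnergy δ₁ δ₂ ω p 0 3 τ' - 4 * δ₂) := by
  by_cases hb : ∃ u, (countsAt δ₁ δ₂ τ ω p u).Bad
  swap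
  · push Not at hb
    obtain ⟨τ', h', hd⟩ := exists_densityAt_eq hδ₁ hδ₂ hωp hτ isPath_parity.neg
      isPath_parity
    refine ⟨τ', h', Or.inl ?_⟩
    refine (layerEnergy_le hδ₁ hδ₂ hω hp (k := 0) (k' := 0) fun u => ?_).trans_eq
      (by push_cast; ring)
    rw [hd]
    have h1 := densityAt_two_one_le (δ₁ := δ₁) (δ₂ := δ₂) (ω := ω) (p := p) hτ u
    have h2 := density_le_of_not_bad (hb u)
    linarith
  obtain ⟨v, hv, hgood⟩ := exists_last_bad τ ω p hδ₁ hδ₂ hω hp hb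
  rcases le_or_gt v (δ₂ - δ₁) with hv1 | hv1
  · exfalso
    have := countsAt_of_low τ ω p hδ₁ hv1
    unfold Counts.Bad at hv
    omega
  have hlow : ∀ u m, u ≤ δ₂ - δ₁ → m ≤ (countsAt δ₁ δ₂ τ ω p v).z ∨
      m ≤ (countsAt δ₁ δ₂ τ ω p v).t → 0 < u → (countsAt δ₁ δ₂ τ ω p u).x = 0 ∧
      (countsAt δ₁ δ₂ τ ω p u).y = 0 ∧ (countsAt δ₁ δ₂ τ ω p u).s = 0 ∧
      (countsAt δ₁ δ₂ τ ω p u).z = 0 ∧ (countsAt δ₁ δ₂ τ ω p u).t = 0 ∧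
      cell (δ₂ - δ₁) δ₂ u = 0 ∧ cell 0 (δ₂ - δ₁) u = 1 ∧ m ≤ (countsAt δ₁ δ₂ τ ω p u).r := by
    intro u m hu hm hu0
    obtain ⟨h1, h2, h3, h4, h5, h6⟩ := countsAt_of_low τ ω p hδ₁ hu
    have := countsAt_le_low τ ω p (u := v) hδ₁ hu0 hu
    exact ⟨h1, h2, h3, h4, h5, h6, cell_eq_one hu0 hu, by omega⟩
  have hnon : ∀ u ≤ 0, (countsAt δ₁ δ₂ τ ω p u).x = 0 ∧ (countsAt δ₁ δ₂ τ ω p u).y = 0 ∧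
      (countsAt δ₁ δ₂ τ ω p u).r = 0 ∧ (countsAt δ₁ δ₂ τ ω p u).z = 0 ∧
      cell (δ₂ - δ₁) δ₂ u = 0 ∧ cell 0 (δ₂ - δ₁) u = 0 ∧ (countsAt δ₁ δ₂ τ ω p u).s = 0 ∧
      (countsAt δ₁ δ₂ τ ω p u).t = 0 ∧ ¬(countsAt δ₁ δ₂ τ ω p u).Bad := by
    intro u hu
    obtain ⟨h1, h2, h3, h4, h5, h6⟩ := countsAt_of_low τ ω p hδ₁ (show u ≤ δ₂ - δ₁ by linarith)
    obtain ⟨h7, h8⟩ := countsAt_of_nonpos (δ₁ := δ₁) (δ₂ := δ₂) τ ω p hu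
    refine ⟨h1, h2, h7, h4, h6, h8, h3, h5, ?_⟩
    unfold Counts.Bad
    omega
  rcases lt_or_ge δ₂ v with hv2 | hv2
  · have hvz := countsAt_of_high τ ω p hδ₁ hv2
    rcases Nat.mod_two_eq_zero_or_one (countsAt δ₁ δ₂ τ ω p v).t with ht | ht
    -- In a high layer x = y = z = 0, so badness with t even leaves only s odd.
    · have hs : (countsAt δ₁ δ₂ τ ω p v).s % 2 = 1 := by
        unfold Counts.Bad at hv
        omega
      obtain ⟨τ', h1, h2⟩ := exists_layerEnergy_of_pivotK hδ₁ hδ₂ hω hp hωp hτ hs ht (by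
        intro u
        rcases lt_or_ge δ₂ u with hu | hu
        · obtain ⟨h1, h2, h3, h4, h5, h6⟩ := countsAt_of_high τ ω p hδ₁ hu
          refine Or.inl ⟨h1, h2, h3, h4, h5, h6, ?_⟩
          rcases le_or_gt u v with huv | huv
          · exact Or.inr (countsAt_high_mono τ ω p hu huv)
          · have := countsAt_high_mono (δ₁ := δ₁) τ ω p hv2 huv.le
            exact Or.inl ⟨this.1, this.2, hgood u huv⟩
        rcases lt_or_ge (δ₂ - δ₁) u with hu' | hu'
        · obtain ⟨h1, h2, h3, h4, h5⟩ := countsAt_of_mid τ ω p hu' hu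
          obtain ⟨h6, h7, h8⟩ := countsAt_high_le_mid τ ω p (u := v) hδ₁ hu' hu
          exact Or.inr (Or.inl ⟨h1, h2, h3, h4, h5, h6, Or.inr ⟨h7, h8⟩⟩)
        rcases le_or_gt u 0 with hu0 | hu0
        · obtain ⟨h1, h2, h3, h4, h5, h6, h7, h8, h9⟩ := hnon u hu0
          exact Or.inl ⟨h1, h2, h3, h4, h5, h6, Or.inl ⟨by omega, by omega, h9⟩⟩
        · exact Or.inr (Or.inr (hlow u _ hu' (Or.inr le_rfl) hu0)))
      exact ⟨τ', h1, Or.inr (Or.inl h2)⟩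
    · obtain ⟨τ', h1, h2⟩ := exists_layerEnergy_of_pivotT hδ₁ hδ₂ hω hp hωp hτ
        -- An odd index beyond every count: the KdV path never reaches its switch.
        (n := 2 * Fintype.card ι + 1) (by omega) ht (by
        intro u
        have hcs : (countsAt δ₁ δ₂ τ ω p u).s ≤ Fintype.card ι := count_le_card _ _ _
        have hcx : (countsAt δ₁ δ₂ τ ω p u).x ≤ Fintype.card ι := count_le_card _ _ _
        have hcy : (countsAt δ₁ δ₂ τ ω p u).y ≤ Fintype.card ι := count_le_card _ _ _
        rcases lt_or_ge δ₂ u with hu | hu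
        · obtain ⟨h1, h2, h3, h4, h5, h6⟩ := countsAt_of_high τ ω p hδ₁ hu
          refine Or.inl ⟨h1, h2, h3, h4, h5, h6, by omega, ?_⟩
          rcases le_or_gt u v with huv | huv
          · exact Or.inr (countsAt_high_mono τ ω p hu huv).2
          · exact Or.inl ⟨(countsAt_high_mono τ ω p hv2 huv.le).2, hgood u huv⟩
        rcases lt_or_ge (δ₂ - δ₁) u with hu' | hu'
        · obtain ⟨h1, h2, h3, h4, h5⟩ := countsAt_of_mid τ ω p hu' hu
          obtain ⟨h6, h7, h8⟩ := countsAt_high_le_mid τ ω p (u := v) hδ₁ hu' hu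
          exact Or.inr (Or.inl ⟨h1, h2, h3, h4, h5, by omega, Or.inr ⟨by omega, h8⟩⟩)
        rcases le_or_gt u 0 with hu0 | hu0
        · obtain ⟨h1, h2, h3, h4, h5, h6, h7, h8, h9⟩ := hnon u hu0
          exact Or.inl ⟨h1, h2, h3, h4, h5, h6, by omega, Or.inl ⟨by omega, h9⟩⟩
        · exact Or.inr (Or.inr (hlow u _ hu' (Or.inr le_rfl) hu0)))
      exact ⟨τ', h1, Or.inr (Or.inr h2)⟩
  · have hvz := countsAt_of_mid τ ω p hv1 hv2
    have hcase : ((countsAt δ₁ δ₂ τ ω p v).x % 2 = 1 ∧ (countsAt δ₁ δ₂ τ ω p v).z % 2 = 1) ∨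
        ((countsAt δ₁ δ₂ τ ω p v).y % 2 = 1 ∧ (countsAt δ₁ δ₂ τ ω p v).z % 2 = 0) := by
      unfold Counts.Bad at hv
      omega
    rcases hcase with ⟨hx, hz⟩ | ⟨hy, hz⟩
    · obtain ⟨τ', h1, h2⟩ := exists_layerEnergy_of_pivotT hδ₁ hδ₂ hω hp hωp hτ hx hz (by
        intro u
        obtain ⟨m1, m2, m3⟩ := countsAt_high_le_mid τ ω p (u := u) hδ₁ hv1 hv2
        rcases lt_or_ge δ₂ u with hu | hu
        · obtain ⟨h1, h2, h3, h4, h5, h6⟩ := countsAt_of_high τ ω p hδ₁ hu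
          exact Or.inl ⟨h1, h2, h3, h4, h5, h6, m1, Or.inl ⟨m3, hgood u (by linarith)⟩⟩
        rcases lt_or_ge (δ₂ - δ₁) u with hu' | hu'
        · obtain ⟨h1, h2, h3, h4, h5⟩ := countsAt_of_mid τ ω p hu' hu
          -- In the middle layers x grows with u while y and z decrease, so above the pivot x is
          -- past its switch and z is before it; below, the roles are exchanged.
          refine Or.inr (Or.inl ⟨h1, h2, h3, h4, h5, countsAt_y_le_x τ ω p hv1 hv2, ?_⟩)
          rcases le_or_gt u v with huv | huv
          · have := countsAt_mid_mono τ ω p hu' huv hv2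
            exact Or.inr ⟨this.1, this.2.2⟩
          · have := countsAt_mid_mono τ ω p hv1 huv.le hu
            exact Or.inl ⟨this.1, this.2.2, hgood u huv⟩
        rcases le_or_gt u 0 with hu0 | hu0
        · obtain ⟨h1, h2, h3, h4, h5, h6, h7, h8, h9⟩ := hnon u hu0
          exact Or.inl ⟨h1, h2, h3, h4, h5, h6, by omega, Or.inl ⟨by omega, h9⟩⟩
        · exact Or.inr (Or.inr (hlow u _ hu' (Or.inl le_rfl) hu0)))
      exact ⟨τ', h1, Or.inr (Or.inr h2)⟩
    · obtain ⟨τ', h1, h2⟩ := exists_layerEnergy_of_pivotK hδ₁ hδ₂ hω hp hωp hτ hy hz (by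
        intro u
        obtain ⟨m1, m2, m3⟩ := countsAt_high_le_mid τ ω p (u := u) hδ₁ hv1 hv2
        rcases lt_or_ge δ₂ u with hu | hu
        · obtain ⟨h1, h2, h3, h4, h5, h6⟩ := countsAt_of_high τ ω p hδ₁ hu
          exact Or.inl ⟨h1, h2, h3, h4, h5, h6, Or.inl ⟨m2, m3, hgood u (by linarith)⟩⟩
        rcases lt_or_ge (δ₂ - δ₁) u with hu' | hu'
        · obtain ⟨h1, h2, h3, h4, h5⟩ := countsAt_of_mid τ ω p hu' hu
          refine Or.inr (Or.inl ⟨h1, h2, h3, h4, h5, countsAt_y_le_x τ ω p hu' hu, ?_⟩)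
          rcases le_or_gt u v with huv | huv
          · exact Or.inr (countsAt_mid_mono τ ω p hu' huv hv2).2
          · have := countsAt_mid_mono τ ω p hv1 huv.le hu
            exact Or.inl ⟨this.2.1, this.2.2, hgood u huv⟩
        rcases le_or_gt u 0 with hu0 | hu0
        · obtain ⟨h1, h2, h3, h4, h5, h6, h7, h8, h9⟩ := hnon u hu0
          exact Or.inl ⟨h1, h2, h3, h4, h5, h6, Or.inl ⟨by omega, by omega, h9⟩⟩
        · exact Or.inr (Or.inr (hlow u _ hu' (Or.inl le_rfl) hu0)))
      exact ⟨τ', h1, Or.inr (Or.inl h2)⟩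

/-- Comparisons of energies in the absence of solitons of Toda type. -/
theorem exists_layerEnergy_of_kdv (hδ₁ : 0 < δ₁) (hδ₂ : δ₁ < δ₂) (hω : ∀ i, 0 ≤ ω i)
    (hp : ∀ i, p i = 0) {τ : ι → ℤ} (hτ : ∀ i, τ i = 0 ∨ τ i = 1 ∨ τ i = -1) :
    (∃ τ' : ι → ℤ, (∀ i, τ' i = τ i ∨ τ' i = -τ i) ∧
      layerEnergy δ₁ δ₂ ω p 0 3 τ ≤ layerEnergy δ₁ δ₂ ω p 0 1 τ' + 4 * δ₁) ∧
    ∃ τ' : ι → ℤ, (∀ i, τ' i = τ i ∨ τ' i = -τ i) ∧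
      layerEnergy δ₁ δ₂ ω p 1 1 τ ≤ layerEnergy δ₁ δ₂ ω p 1 (-1) τ' ∧
      layerEnergy δ₁ δ₂ ω p 1 (-1) τ ≤ layerEnergy δ₁ δ₂ ω p 1 1 τ' + 4 * δ₁ := by
  have hz : ∀ f, IsThreshold f → ∑ i, τ i * f (p i) = 0 := fun f hf => by
    simp [hp, hf.at_zero]
  have hc : ∀ f, IsThreshold f → count τ p f = 0 := fun f hf =>
    count_eq_zero _ _ fun i => by rw [hp, hf.at_zero]
  have hd0 : ∀ a b u, densityAt δ₁ δ₂ ω p a b τ u = density a b (∑ i, τ i * lowK δ₁ δ₂ u (ω i))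
      (∑ i, τ i * midK δ₁ δ₂ u (ω i)) (∑ i, τ i * highK δ₁ δ₂ u (ω i)) 0 0 0 := by
    intro a b u
    rw [densityAt, hz _ (isThreshold_lowT u), hz _ (isThreshold_midT hδ₂ u),
      hz _ (isThreshold_highT (hδ₁.trans hδ₂) u)]
  have hcz : ∀ u, (countsAt δ₁ δ₂ τ ω p u).r = 0 ∧ (countsAt δ₁ δ₂ τ ω p u).z = 0 ∧
      (countsAt δ₁ δ₂ τ ω p u).t = 0 := fun u =>
    ⟨hc _ (isThreshold_lowT u), hc _ (isThreshold_midT hδ₂ u),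
      hc _ (isThreshold_highT (hδ₁.trans hδ₂) u)⟩
  have hp0 : ∀ i, 0 ≤ p i := fun i => (hp i).ge
  have hωp : ∀ i, ω i = 0 ∨ p i = 0 := fun i => Or.inr (hp i)
  have hκ : ∀ u, (cell (δ₂ - δ₁) δ₂ u = 1 ∨ (cell (δ₂ - δ₁) δ₂ u = 0 ∧
      (countsAt δ₁ δ₂ τ ω p u).x = 0)) := by
    intro u
    rcases countsAt_isLayer (δ₁ := δ₁) (δ₂ := δ₂) (u := u) τ ω p hδ₁ with h | h | h
    · exact Or.inr ⟨h.2.2.2.2.1, h.1⟩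
    · exact Or.inl h.2.2.2.1
    · exact Or.inr ⟨h.2.2.2.2.2.1, h.1⟩
  refine ⟨?_, ?_⟩
  · obtain ⟨τ', h', hd⟩ := exists_densityAt_eq hδ₁ hδ₂ hωp hτ isPath_parity.neg
      isPath_parity
    refine ⟨τ', h', (layerEnergy_le hδ₁ hδ₂ hω hp0 (k := 4) (k' := 0) fun u => ?_).trans_eq
      (by push_cast; ring)⟩
    obtain ⟨hx, hy, hs, -⟩ := densityAt_compat (δ₁ := δ₁) (δ₂ := δ₂) (ω := ω) (p := p) τ hτ u
    obtain ⟨hr, hz, ht⟩ := hcz u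
    rw [hd, hd0]
    simp only [Counts.density, density, hr, hz, ht, parity_zero]
    generalize ∑ i, τ i * lowK δ₁ δ₂ u (ω i) = x at *
    generalize ∑ i, τ i * midK δ₁ δ₂ u (ω i) = y at *
    generalize ∑ i, τ i * highK δ₁ δ₂ u (ω i) = s at *
    have px := parity_eq (countsAt δ₁ δ₂ τ ω p u).x
    have py := parity_eq (countsAt δ₁ δ₂ τ ω p u).y
    have ps := parity_eq (countsAt δ₁ δ₂ τ ω p u).s
    unfold Compat at *
    have h1 : parity (countsAt δ₁ δ₂ τ ω p u).y ^ 2 ≤ y ^ 2 :=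
      sq_le_sq_of_parity (by omega) (by omega) (by omega)
    have h2 : parity (countsAt δ₁ δ₂ τ ω p u).s ^ 2 ≤ s ^ 2 :=
      sq_le_sq_of_parity (by omega) (by omega) (by omega)
    have h3 : parity (countsAt δ₁ δ₂ τ ω p u).x ^ 2 = parity (countsAt δ₁ δ₂ τ ω p u).x := by
      rcases px with h | h <;> simp [h.2]
    -- This is (x + 1)(x + 2) ≥ 0, which bounds −6x − 2x² by 4.
    have h4 := Int.le_self_sq (x + 2)
    have h5 : -6 * x - 2 * x ^ 2 ≤ 4 * cell (δ₂ - δ₁) δ₂ u := by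
      rcases hκ u with h | h
      · rw [h]; linarith
      · rw [h.1, hx.2 h.2]; norm_num
    linarith
  · obtain ⟨τ', h', hd⟩ := exists_densityAt_eq hδ₁ hδ₂ hωp hτ isPath_parity isPath_parity
    refine ⟨τ', h', (layerEnergy_le hδ₁ hδ₂ hω hp0 (k := 0) (k' := 0) fun u => ?_).trans_eq
      (by push_cast; ring), (layerEnergy_le hδ₁ hδ₂ hω hp0 (k := 4) (k' := 0) fun u => ?_).trans_eq
      (by push_cast; ring)⟩
    all_goals
      obtain ⟨hx, hy, hs, -⟩ := densityAt_compat (δ₁ := δ₁) (δ₂ := δ₂) (ω := ω) (p := p) τ hτ u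
      obtain ⟨hr, hz, ht⟩ := hcz u
      rw [hd, hd0]
      simp only [Counts.density, density, hr, hz, ht, parity_zero]
      generalize ∑ i, τ i * lowK δ₁ δ₂ u (ω i) = x at *
      generalize ∑ i, τ i * midK δ₁ δ₂ u (ω i) = y at *
      generalize ∑ i, τ i * highK δ₁ δ₂ u (ω i) = s at *
      have px := parity_eq (countsAt δ₁ δ₂ τ ω p u).x
      have py := parity_eq (countsAt δ₁ δ₂ τ ω p u).y
      have ps := parity_eq (countsAt δ₁ δ₂ τ ω p u).s
      unfold Compat at *
      have h1 : parity (countsAt δ₁ δ₂ τ ω p u).y ^ 2 = parity (countsAt δ₁ δ₂ τ ω p u).y := by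
        rcases py with h | h <;> simp [h.2]
      have h2 : parity (countsAt δ₁ δ₂ τ ω p u).s ^ 2 = parity (countsAt δ₁ δ₂ τ ω p u).s := by
        rcases ps with h | h <;> simp [h.2]
      have h3 : parity (countsAt δ₁ δ₂ τ ω p u).x ^ 2 = parity (countsAt δ₁ δ₂ τ ω p u).x := by
        rcases px with h | h <;> simp [h.2]
      have h4 := Int.le_self_sq y
      have h5 := Int.le_self_sq s
      have h6 : 0 ≤ parity (countsAt δ₁ δ₂ τ ω p u).x := by omega
    · have h7 := sq_nonneg x
      linarith
    · have h7 : 4 * x - 2 * x ^ 2 ≤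
          4 * cell (δ₂ - δ₁) δ₂ u - 2 * parity (countsAt δ₁ δ₂ τ ω p u).x := by
        rcases hκ u with h | h
        · have := sq_nonneg (x - 1)
          have : parity (countsAt δ₁ δ₂ τ ω p u).x ≤ 1 := by omega
          rw [h]; linarith
        · rw [h.1, h.2, hx.2 h.2]; simp [parity_zero]
      linarith

end Spins

/-! ### Reduction to nonnegative parameters and the ultradiscrete equation -/

section Solitons

/-- The sign of a real number, with value `1` at `0`. -/
def sgn (x : ℝ) : ℤ := if 0 ≤ x then 1 else -1

theorem sgn_of_nonneg {x : ℝ} (h : 0 ≤ x) : sgn x = 1 := if_pos h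

theorem sgn_of_neg {x : ℝ} (h : x < 0) : sgn x = -1 := if_neg h.not_ge

theorem sgn_eq (x : ℝ) : sgn x = 1 ∨ sgn x = -1 := by
  unfold sgn
  split_ifs <;> simp

theorem sgn_mul_abs (x : ℝ) : (sgn x : ℝ) * |x| = x := by
  rcases le_or_gt 0 x with h | h
  · rw [sgn_of_nonneg h, abs_of_nonneg h]; simp
  · rw [sgn_of_neg h, abs_of_neg h]; simp

theorem dispK_zero (δ₁ : ℝ) : dispK δ₁ 0 = 0 := by simp [dispK]

theorem dispQ_zero {δ₂ : ℝ} (h : 0 < δ₂) : dispQ δ₂ 0 = 0 := by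
  rw [dispQ, max_eq_left (by linarith), min_eq_left (by linarith)]; simp

theorem dispK_neg (δ₁ Ω : ℝ) : dispK δ₁ (-Ω) = -dispK δ₁ Ω := by
  have h1 : |-Ω - δ₁| = |Ω + δ₁| := by rw [← abs_neg]; ring_nf
  have h2 : |-Ω + δ₁| = |Ω - δ₁| := by rw [← abs_neg]; ring_nf
  rw [dispK, dispK, h1, h2]; ring

theorem dispQ_neg (δ₂ P : ℝ) : dispQ δ₂ (-P) = -dispQ δ₂ P := by
  rw [dispQ, dispQ]; grind

theorem dispK_sgn (δ₁ Ω : ℝ) : dispK δ₁ Ω = sgn Ω * dispK δ₁ |Ω| := by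
  rcases le_or_gt 0 Ω with h | h
  · rw [sgn_of_nonneg h, abs_of_nonneg h]; simp
  · rw [sgn_of_neg h, abs_of_neg h, dispK_neg]; simp

theorem dispQ_sgn (δ₂ P : ℝ) : dispQ δ₂ P = sgn P * dispQ δ₂ |P| := by
  rcases le_or_gt 0 P with h | h
  · rw [sgn_of_nonneg h, abs_of_nonneg h]; simp
  · rw [sgn_of_neg h, abs_of_neg h, dispQ_neg]; simp

theorem interMixed_zero_left (δ₁ δ₂ P : ℝ) : interMixed δ₁ δ₂ 0 P = 0 := by
  simp [interMixed]

theorem interMixed_zero_right (δ₁ δ₂ Ω : ℝ) : interMixed δ₁ δ₂ Ω 0 = 0 := by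
  simp [interMixed]

theorem interMixed_sgn (δ₁ δ₂ Ω P : ℝ) :
    interMixed δ₁ δ₂ Ω P = sgn Ω * sgn P * interMixed δ₁ δ₂ |Ω| |P| := by
  rcases lt_trichotomy Ω 0 with h | rfl | h
  · rcases lt_trichotomy P 0 with h' | rfl | h'
    · rw [sgn_of_neg h, sgn_of_neg h', abs_of_neg h, abs_of_neg h']
      simp [interMixed, h, h', h.not_gt, h'.not_gt, dispK_neg, dispQ_neg, sub_eq_add_neg]
    · simp [interMixed_zero_right]
    · rw [sgn_of_neg h, sgn_of_nonneg h'.le, abs_of_neg h, abs_of_pos h']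
      simp [interMixed, h, h', h.not_gt, h'.not_gt, dispK_neg, sub_eq_add_neg]
  · simp [interMixed_zero_left]
  · rcases lt_trichotomy P 0 with h' | rfl | h'
    · rw [sgn_of_nonneg h.le, sgn_of_neg h', abs_of_pos h, abs_of_neg h']
      simp [interMixed, h, h', h'.not_gt, dispQ_neg]
    · simp [interMixed_zero_right]
    · rw [sgn_of_nonneg h.le, sgn_of_nonneg h'.le, abs_of_pos h, abs_of_pos h']
      simp

theorem interKdV_sgn (Ω Ω' : ℝ) :
    interKdV Ω Ω' = sgn Ω * sgn Ω' * (-2 * min |Ω| |Ω'|) := by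
  rw [interKdV]
  rcases le_or_gt 0 Ω with h | h <;> rcases le_or_gt 0 Ω' with h' | h' <;>
    simp only [sgn_of_nonneg, sgn_of_neg, abs_of_nonneg, abs_of_neg, h, h'] <;> push_cast <;> grind

theorem interToda_sgn {δ₂ : ℝ} (hδ : 0 < δ₂) (P P' : ℝ) :
    interToda δ₂ P P' = sgn P * sgn P' * (-(2 * min |P| |P'| + dispQ δ₂ (min |P| |P'|))) := by
  rw [interToda]
  have hm : ∀ x, 0 ≤ x → dispQ δ₂ x = max 0 (x - δ₂) := by
    intro x hx
    rw [dispQ, min_eq_left (by linarith), add_zero]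
  rw [dispQ_sgn δ₂ P, dispQ_sgn δ₂ P', hm _ (abs_nonneg P), hm _ (abs_nonneg P'),
    hm _ (le_min (abs_nonneg P) (abs_nonneg P'))]
  rcases le_or_gt 0 P with h | h <;> rcases le_or_gt 0 P' with h' | h' <;>
    simp only [sgn_of_nonneg, sgn_of_neg, abs_of_nonneg, abs_of_neg, h, h'] <;> push_cast <;>
    grind

variable {N M : ℕ}

/-- The moduli of the parameters of KdV type, extended by `0`. -/
def absOmega (Ω : Fin N → ℝ) (M : ℕ) (i : Fin (N + M)) : ℝ :=
  Fin.addCases (motive := fun _ => ℝ) (fun a => |Ω a|) (fun _ => 0) i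

/-- The moduli of the parameters of Toda type, extended by `0`. -/
def absP (N : ℕ) (P : Fin M → ℝ) (i : Fin (N + M)) : ℝ :=
  Fin.addCases (motive := fun _ => ℝ) (fun _ => 0) (fun b => |P b|) i

/-- The signs of the parameters. -/
def signs (Ω : Fin N → ℝ) (P : Fin M → ℝ) (i : Fin (N + M)) : ℤ :=
  Fin.addCases (motive := fun _ => ℤ) (fun a => sgn (Ω a)) (fun b => sgn (P b)) i

variable (δ₁ δ₂ : ℝ) (Ω : Fin N → ℝ) (P : Fin M → ℝ) (C : Fin (N + M) → ℝ)

theorem absOmega_nonneg (i : Fin (N + M)) : 0 ≤ absOmega Ω M i := by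
  refine Fin.addCases (fun a => ?_) (fun b => ?_) i <;> simp [absOmega]

theorem absP_nonneg (i : Fin (N + M)) : 0 ≤ absP N P i := by
  refine Fin.addCases (fun a => ?_) (fun b => ?_) i <;> simp [absP]

theorem absOmega_eq_zero_or (i : Fin (N + M)) : absOmega Ω M i = 0 ∨ absP N P i = 0 := by
  refine Fin.addCases (fun a => ?_) (fun b => ?_) i <;> simp [absOmega, absP]

theorem signs_eq (i : Fin (N + M)) : signs Ω P i = 1 ∨ signs Ω P i = -1 := by
  refine Fin.addCases (fun a => ?_) (fun b => ?_) i
  · simpa [signs] using sgn_eq (Ω a)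
  · simpa [signs] using sgn_eq (P b)

variable {δ₁ δ₂}

theorem phase_eq (hδ₂ : 0 < δ₂) (i : Fin (N + M)) (m n : ℤ) :
    phase δ₁ δ₂ Ω P C i m n =
      signs Ω P i * field δ₁ δ₂ m n (absOmega Ω M i) (absP N P i) + C i := by
  refine Fin.addCases (fun a => ?_) (fun b => ?_) i
  · simp only [phase, signs, absOmega, absP, field, Fin.addCases_left, dispQ_zero hδ₂]
    rw [dispK_sgn δ₁ (Ω a)]
    nth_rewrite 1 [← sgn_mul_abs (Ω a)]
    ring
  · simp only [phase, signs, absOmega, absP, field, Fin.addCases_right, dispK_zero]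
    rw [dispQ_sgn δ₂ (P b)]
    nth_rewrite 3 [← sgn_mul_abs (P b)]
    ring

theorem inter_eq (hδ₂ : 0 < δ₂) (i j : Fin (N + M)) :
    inter δ₁ δ₂ Ω P i j = signs Ω P i * signs Ω P j *
      coupling δ₁ δ₂ (absOmega Ω M i) (absP N P i) (absOmega Ω M j) (absP N P j) := by
  have hl : ∀ x : ℝ, min |x| 0 = 0 := fun x => min_eq_right (abs_nonneg x)
  have hr : ∀ x : ℝ, min 0 |x| = 0 := fun x => min_eq_left (abs_nonneg x)
  refine Fin.addCases (fun a => ?_) (fun b => ?_) i <;>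
    refine Fin.addCases (fun a' => ?_) (fun b' => ?_) j <;>
    simp only [inter, signs, absOmega, absP, coupling, Fin.addCases_left, Fin.addCases_right,
      interMixed_zero_left, interMixed_zero_right, min_self, dispQ_zero hδ₂, hl, hr]
  · rw [interKdV_sgn]; ring
  · rw [interMixed_sgn]; ring
  · rw [interMixed_sgn]; ring
  · rw [interToda_sgn hδ₂]; ring

theorem inter_comm (hδ₂ : 0 < δ₂) (i j : Fin (N + M)) :
    inter δ₁ δ₂ Ω P i j = inter δ₁ δ₂ Ω P j i := by
  rw [inter_eq Ω P hδ₂, inter_eq Ω P hδ₂, coupling_comm]; ring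

theorem mixedSoliton_eq (m n : ℤ) : mixedSoliton δ₁ δ₂ Ω P C m n =
    maxWeight (fun i => phase δ₁ δ₂ Ω P C i m n) (inter δ₁ δ₂ Ω P) := rfl

/-- The interface between F and energies: τ comes from a maximising pair at the first two points,
and any sign change of it gives a competing pair at any two points with the same sum. -/
theorem exists_spins_le (hδ₂ : 0 < δ₂) (m₁ n₁ m₂ n₂ a b : ℤ)
    (ha : m₁ - m₂ = a) (hb : n₁ - n₂ = b) :
    ∃ τ : Fin (N + M) → ℤ, (∀ i, τ i = 0 ∨ τ i = 1 ∨ τ i = -1) ∧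
      ∀ τ' : Fin (N + M) → ℤ, (∀ i, τ' i = τ i ∨ τ' i = -τ i) → ∀ m₁' n₁' m₂' n₂' a' b' : ℤ,
        m₁ + m₂ = m₁' + m₂' → n₁ + n₂ = n₁' + n₂' → m₁' - m₂' = a' → n₁' - n₂' = b' →
        4 * (mixedSoliton δ₁ δ₂ Ω P C m₁ n₁ + mixedSoliton δ₁ δ₂ Ω P C m₂ n₂) -
          layerEnergy δ₁ δ₂ (absOmega Ω M) (absP N P) a b τ ≤
        4 * (mixedSoliton δ₁ δ₂ Ω P C m₁' n₁' + mixedSoliton δ₁ δ₂ Ω P C m₂' n₂') -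
          layerEnergy δ₁ δ₂ (absOmega Ω M) (absP N P) a' b' τ' := by
  obtain ⟨I, hI⟩ := exists_maxWeight_eq (fun i => phase δ₁ δ₂ Ω P C i m₁ n₁) (inter δ₁ δ₂ Ω P)
  obtain ⟨J, hJ⟩ := exists_maxWeight_eq (fun i => phase δ₁ δ₂ Ω P C i m₂ n₂) (inter δ₁ δ₂ Ω P)
  have hchi : ∀ i, chi I i - chi J i = 0 ∨ chi I i - chi J i = 1 ∨ chi I i - chi J i = -1 := by
    intro i
    unfold chi
    split_ifs <;> simp
  have hsq : ∀ i, signs Ω P i * signs Ω P i = 1 := fun i => by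
    rcases signs_eq Ω P i with h | h <;> simp [h]
  -- The spins are gauged by the signs of the parameters, so the energies involve only absolute
  -- values.
  refine ⟨fun i => signs Ω P i * (chi I i - chi J i), fun i => ?_, ?_⟩
  · have := hchi i
    dsimp only
    rcases signs_eq Ω P i with h | h <;> rw [h] <;> omega
  intro τ' hτ' m₁' n₁' m₂' n₂' a' b' hm hn ha' hb'
  have hcast : (m₁ : ℝ) + m₂ = m₁' + m₂' ∧ (n₁ : ℝ) + n₂ = n₁' + n₂' :=
    ⟨by exact_mod_cast hm, by exact_mod_cast hn⟩
  have key := weight_add_weight_le (fun i => phase δ₁ δ₂ Ω P C i m₁ n₁)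
    (fun i => phase δ₁ δ₂ Ω P C i m₂ n₂) (fun i => phase δ₁ δ₂ Ω P C i m₁' n₁')
    (fun i => phase δ₁ δ₂ Ω P C i m₂' n₂') (inter δ₁ δ₂ Ω P) (inter_comm Ω P hδ₂) (by
      intro i
      simp only [phase_eq Ω P C hδ₂, field]
      linear_combination signs Ω P i * (absOmega Ω M i + dispQ δ₂ (absP N P i)) * hcast.1 +
        signs Ω P i * (absP N P i + dispK δ₁ (absOmega Ω M i)) * hcast.2)
    I J (fun i => signs Ω P i * τ' i) (by
      intro i
      have h1 := hτ' i
      dsimp only at h1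
      rcases h1 with h | h
      · left; rw [h, ← mul_assoc, hsq, one_mul]
      · right; rw [h, mul_neg, ← mul_assoc, hsq, one_mul])
  have hE : ∀ (k₁ l₁ k₂ l₂ a b : ℤ) (τ : Fin (N + M) → ℤ), k₁ - k₂ = a → l₁ - l₂ = b →
      spinEnergy (fun i => phase δ₁ δ₂ Ω P C i k₁ l₁ - phase δ₁ δ₂ Ω P C i k₂ l₂)
        (inter δ₁ δ₂ Ω P) τ =
      layerEnergy δ₁ δ₂ (absOmega Ω M) (absP N P) a b (fun i => signs Ω P i * τ i) := by
    rintro k₁ l₁ k₂ l₂ a b τ rfl rfl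
    refine spinEnergy_sign _ _ _ _ _ _ (fun i => ?_) (inter_eq Ω P hδ₂)
    simp only [phase_eq Ω P C hδ₂, field]
    push_cast
    ring
  rw [hE m₁ n₁ m₂ n₂ a b _ ha hb, hE m₁' n₁' m₂' n₂' a' b' _ ha' hb', ← hI, ← hJ] at key
  have hτ'' : (fun i => signs Ω P i * (signs Ω P i * τ' i)) = τ' := by
    funext i
    rw [← mul_assoc, hsq, one_mul]
  rw [hτ''] at key
  exact key

theorem solvesEBB_mixedSoliton (hδ₁ : 0 < δ₁) (hδ₂ : δ₁ < δ₂) :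
    SolvesEBB δ₁ δ₂ (mixedSoliton δ₁ δ₂ Ω P C) := by
  intro m n
  have hω := absOmega_nonneg (M := M) Ω
  have hp := absP_nonneg (N := N) P
  have hωp := absOmega_eq_zero_or Ω P
  have h0 := hδ₁.trans hδ₂
  apply le_antisymm
  · obtain ⟨τ, hτ, h⟩ := exists_spins_le (δ₁ := δ₁) Ω P C h0 (m + 1) (n + 1) (m - 1) n 2 1
      (by ring) (by ring)
    obtain ⟨τ', hτ', h' | h' | h'⟩ := exists_layerEnergy_two_one_le hδ₁ hδ₂ hω hp hωp hτ
    · have := h τ' hτ' m (n + 1) m n 0 1 (by ring) (by ring) (by ring) (by ring)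
      exact le_max_of_le_left (by linarith)
    · have := h τ' hτ' (m + 1) n (m - 1) (n + 1) 2 (-1) (by ring) (by ring) (by ring) (by ring)
      exact le_max_of_le_right (le_max_of_le_left (by linarith))
    · have := h τ' hτ' m (n + 2) m (n - 1) 0 3 (by ring) (by ring) (by ring) (by ring)
      exact le_max_of_le_right (le_max_of_le_right (by linarith))
  · refine max_le ?_ (max_le ?_ ?_)
    · obtain ⟨τ, hτ, h⟩ := exists_spins_le (δ₁ := δ₁) Ω P C h0 m (n + 1) m n 0 1
        (by ring) (by ring)
      obtain ⟨τ', hτ', h', -⟩ := exists_layerEnergy_two_one_ge hδ₁ hδ₂ hω hp hωp hτ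
      have := h τ' hτ' (m + 1) (n + 1) (m - 1) n 2 1 (by ring) (by ring) (by ring) (by ring)
      linarith
    · obtain ⟨τ, hτ, h⟩ := exists_spins_le (δ₁ := δ₁) Ω P C h0 (m + 1) n (m - 1) (n + 1) 2 (-1)
        (by ring) (by ring)
      obtain ⟨τ', hτ', -, h', -⟩ := exists_layerEnergy_two_one_ge hδ₁ hδ₂ hω hp hωp hτ
      have := h τ' hτ' (m + 1) (n + 1) (m - 1) n 2 1 (by ring) (by ring) (by ring) (by ring)
      linarith
    · obtain ⟨τ, hτ, h⟩ := exists_spins_le (δ₁ := δ₁) Ω P C h0 m (n + 2) m (n - 1) 0 3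
        (by ring) (by ring)
      obtain ⟨τ', hτ', -, -, h'⟩ := exists_layerEnergy_two_one_ge hδ₁ hδ₂ hω hp hωp hτ
      have := h τ' hτ' (m + 1) (n + 1) (m - 1) n 2 1 (by ring) (by ring) (by ring) (by ring)
      linarith

end Solitons

/-! ### Behaviour of F near infinity and telescoping of the carrier -/

section Asymptotics

open Filter

/-- A minimiser of the sum of k contains all negative terms and no positive ones, so it is free only
where k = 0, and there a vanishes too. -/
theorem sum_negative_part_le {ι : Type*} [Fintype ι] [DecidableEq ι] (a k : ι → ℝ)
    (hak : ∀ i, k i = 0 → a i = 0) (I : Finset ι) :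
    ∑ i with k i < 0, k i ≤ ∑ i ∈ I, k i ∧
      (∑ i ∈ I, k i = ∑ i with k i < 0, k i → ∑ i ∈ I, a i = ∑ i with k i < 0, a i) := by
  have hsum : ∀ f : ι → ℝ, ∑ i ∈ I, f i - ∑ i with k i < 0, f i =
      ∑ i, ((if i ∈ I then f i else 0) - if k i < 0 then f i else 0) := by
    intro f
    rw [Finset.sum_sub_distrib, Finset.sum_filter, Finset.sum_ite_mem, Finset.univ_inter]
  have hnn : ∀ i ∈ Finset.univ, 0 ≤ (if i ∈ I then k i else 0) - if k i < 0 then k i else 0 := by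
    intro i _
    split_ifs <;> linarith
  refine ⟨?_, fun h => ?_⟩
  · have := hsum k
    have := Finset.sum_nonneg hnn
    linarith
  · have h0 := hsum k
    rw [h, sub_self] at h0
    have h1 := (Finset.sum_eq_zero_iff_of_nonneg hnn).mp h0.symm
    refine sub_eq_zero.mp ((hsum a).trans (Finset.sum_eq_zero fun i hi => ?_))
    have h3 := h1 i hi
    by_cases h4 : k i = 0
    · simp [hak i h4]
    · by_cases h5 : i ∈ I <;> by_cases h6 : k i < 0 <;> simp [h4, h5, h6] at h3 ⊢

/-- As n → −∞ the subsets of least n-slope win. They all have the same m-slope, so the winner among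
them is decided by constants alone and does not depend on m. -/
theorem maxWeight_eventually_affine {ι : Type*} [Fintype ι] [LinearOrder ι] (a k c : ι → ℝ)
    (B : ι → ι → ℝ) (hak : ∀ i, k i = 0 → a i = 0) :
    ∃ α β γ : ℝ, ∀ m : ℤ, ∀ᶠ n : ℤ in atBot,
      maxWeight (fun i => a i * m + k i * n + c i) B = α * m + β * n + γ := by
  have hw : ∀ (m n : ℤ) I, weight (fun i => a i * m + k i * n + c i) B I =
      (∑ i ∈ I, a i) * m + (∑ i ∈ I, k i) * n + weight c B I := by
    intro m n I
    rw [weight, weight, Finset.sum_add_distrib, Finset.sum_add_distrib, Finset.sum_mul,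
      Finset.sum_mul]
    ring
  let I₀ : Finset ι := {i | k i < 0}
  obtain ⟨I₁, hI₁, hmax⟩ := Finset.exists_max_image
    ((Finset.univ : Finset (Finset ι)).filter fun I => ∑ i ∈ I, k i = ∑ i ∈ I₀, k i)
    (weight c B) ⟨I₀, by simp⟩
  have hk₁ := (Finset.mem_filter.mp hI₁).2
  refine ⟨∑ i ∈ I₀, a i, ∑ i ∈ I₀, k i, weight c B I₁, fun m => ?_⟩
  have hev : ∀ᶠ n : ℤ in atBot, ∀ I : Finset ι,
      weight (fun i => a i * m + k i * n + c i) B I ≤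
        (∑ i ∈ I₀, a i) * m + (∑ i ∈ I₀, k i) * n + weight c B I₁ := by
    refine eventually_all.mpr fun I => ?_
    obtain ⟨h1, h2⟩ := sum_negative_part_le a k hak I
    rcases h1.eq_or_lt with h | h
    · refine Eventually.of_forall fun n => ?_
      have h3 := hmax I (by simpa using h.symm)
      rw [hw, h2 h.symm, h.symm]
      simp only [I₀]
      linarith
    · have ht : Tendsto (fun n : ℤ => (∑ i ∈ I, k i - ∑ i ∈ I₀, k i) * (n : ℝ)) atBot atBot :=
        (tendsto_intCast_atBot_iff (R := ℝ) |>.mpr tendsto_id).const_mul_atBot (sub_pos.mpr h)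
      filter_upwards [ht.eventually_le_atBot ((∑ i ∈ I₀, a i) * m + weight c B I₁ -
        (∑ i ∈ I, a i) * m - weight c B I)] with n hn
      rw [hw]
      linarith
  filter_upwards [hev] with n hn
  apply le_antisymm
  · exact Finset.sup'_le _ _ fun I _ => hn I
  · refine le_trans (le_of_eq ?_) (weight_le_maxWeight _ B I₁)
    rw [hw, hk₁, (sum_negative_part_le a k hak I₁).2 hk₁]

/-- The sequence of differences of a sequence vanishing near `-∞` sums up to it. -/
theorem carrierLoad_eq {u u' V : ℤ → ℝ} (h : ∀ k, u (k - 1) - u' (k - 1) = V k - V (k - 1))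
    (hV : ∀ᶠ k in atBot, V k = 0) (n : ℤ) : carrierLoad u u' n = V n := by
  obtain ⟨k₀, hk₀⟩ := eventually_atBot.mp hV
  have htel : ∀ l : ℤ, ∀ n, l ≤ n → ∑ k ∈ Finset.Ioc l n, (V k - V (k - 1)) = V n - V l := by
    intro l n hn
    induction n, hn using Int.leInduction with
    | base => simp
    | succ n hn ih =>
      have : Finset.Ioc l (n + 1) = insert (n + 1) (Finset.Ioc l n) := by
        ext x
        simp only [Finset.mem_Ioc, Finset.mem_insert]
        omega
      rw [this, Finset.sum_insert (by simp), ih]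
      simp
  -- Starting at or below k₀ makes the lower boundary term of the telescoping sum zero.
  have hl := htel (min k₀ n) n (min_le_right _ _)
  rw [hk₀ _ (min_le_left _ _), sub_zero] at hl
  rw [carrierLoad, ← hl]
  simp only [h]
  refine finsum_mem_eq_sum_of_inter_support_eq (s := Set.Iic n) _ ?_
  ext x
  simp only [Set.mem_inter_iff, Function.mem_support, Finset.coe_Ioc, Set.mem_Ioc, Set.mem_Iic]
  constructor
  · rintro ⟨h1, h2⟩
    refine ⟨⟨?_, h1⟩, h2⟩
    by_contra! h3
    exact h2 (by rw [hk₀ x (h3.trans (min_le_left _ _)),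
      hk₀ (x - 1) (by have := h3.trans (min_le_left _ _); omega), sub_zero])
  · rintro ⟨h1, h2⟩
    exact ⟨h1.2, h2⟩

end Asymptotics

/-! ### The case M = 0: the Box-Ball system -/

section BoxBall

open Filter

variable {N : ℕ} {δ₁ δ₂ : ℝ} (Ω : Fin N → ℝ) (P : Fin 0 → ℝ) (C : Fin (N + 0) → ℝ)

theorem absP_of_isEmpty (i : Fin (N + 0)) : absP N P i = 0 := by
  refine Fin.addCases (fun a => ?_) (fun b => b.elim0) i
  rw [absP, Fin.addCases_left]

/-- The first inequality compares the directions (0,3) and (0,1), the other two (1,1) and (1,−1).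
They bound X at two neighbouring sites and give 0 ≤ U ≤ δ₁. -/
theorem kdv_inequalities (hδ₁ : 0 < δ₁) (hδ₂ : δ₁ < δ₂) (m n : ℤ) :
    (mixedSoliton δ₁ δ₂ Ω P C m (n + 2) + mixedSoliton δ₁ δ₂ Ω P C m (n - 1) ≤
      mixedSoliton δ₁ δ₂ Ω P C m (n + 1) + mixedSoliton δ₁ δ₂ Ω P C m n + δ₁) ∧
    (mixedSoliton δ₁ δ₂ Ω P C (m + 1) (n + 1) + mixedSoliton δ₁ δ₂ Ω P C m n ≤
      mixedSoliton δ₁ δ₂ Ω P C (m + 1) n + mixedSoliton δ₁ δ₂ Ω P C m (n + 1)) ∧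
    (mixedSoliton δ₁ δ₂ Ω P C (m + 1) n + mixedSoliton δ₁ δ₂ Ω P C m (n + 1) ≤
      mixedSoliton δ₁ δ₂ Ω P C (m + 1) (n + 1) + mixedSoliton δ₁ δ₂ Ω P C m n + δ₁) := by
  have hω := absOmega_nonneg (M := 0) Ω
  have hp := absP_of_isEmpty (N := N) P
  have h0 := hδ₁.trans hδ₂
  refine ⟨?_, ?_, ?_⟩
  · obtain ⟨τ, hτ, h⟩ := exists_spins_le (δ₁ := δ₁) Ω P C h0 m (n + 2) m (n - 1) 0 3
      (by ring) (by ring)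
    obtain ⟨⟨τ', hτ', h'⟩, -⟩ := exists_layerEnergy_of_kdv hδ₁ hδ₂ hω hp hτ
    have := h τ' hτ' m (n + 1) m n 0 1 (by ring) (by ring) (by ring) (by ring)
    linarith
  · obtain ⟨τ, hτ, h⟩ := exists_spins_le (δ₁ := δ₁) Ω P C h0 (m + 1) (n + 1) m n 1 1
      (by ring) (by ring)
    obtain ⟨-, τ', hτ', h', -⟩ := exists_layerEnergy_of_kdv hδ₁ hδ₂ hω hp hτ
    have := h τ' hτ' (m + 1) n m (n + 1) 1 (-1) (by ring) (by ring) (by ring) (by ring)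
    linarith
  · obtain ⟨τ, hτ, h⟩ := exists_spins_le (δ₁ := δ₁) Ω P C h0 (m + 1) n m (n + 1) 1 (-1)
      (by ring) (by ring)
    obtain ⟨-, τ', hτ', -, h'⟩ := exists_layerEnergy_of_kdv hδ₁ hδ₂ hω hp hτ
    have := h τ' hτ' (m + 1) (n + 1) m n 1 1 (by ring) (by ring) (by ring) (by ring)
    linarith

theorem mixedSoliton_eventually_affine (hδ₁ : 0 < δ₁) (hδ₂ : 0 < δ₂) :
    (∃ α β γ : ℝ, ∀ m : ℤ, ∀ᶠ n : ℤ in atBot,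
      mixedSoliton δ₁ δ₂ Ω P C m n = α * m + β * n + γ) ∧
    ∃ α β γ : ℝ, ∀ m : ℤ, ∀ᶠ n : ℤ in atTop,
      mixedSoliton δ₁ δ₂ Ω P C m n = α * m + β * n + γ := by
  have hp := absP_of_isEmpty (N := N) P
  let a : Fin (N + 0) → ℝ := fun i => signs Ω P i * absOmega Ω 0 i
  let k : Fin (N + 0) → ℝ := fun i => signs Ω P i * dispK δ₁ (absOmega Ω 0 i)
  have hak : ∀ i, k i = 0 → a i = 0 := by
    intro i hi
    have hs : (signs Ω P i : ℝ) ≠ 0 := by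
      rcases signs_eq Ω P i with h | h <;> simp [h]
    have hK := (mul_eq_zero.mp hi).resolve_left hs
    have hω : absOmega Ω 0 i = 0 := by
      have := absOmega_nonneg (M := 0) Ω i
      -- For ω ≥ 0 one has K = −min(ω, δ₁), so K = 0 forces ω = 0 as δ₁ > 0.
      rw [dispK] at hK
      grind
    simp [a, hω]
  have hF : ∀ m n : ℤ, mixedSoliton δ₁ δ₂ Ω P C m n =
      maxWeight (fun i => a i * m + k i * n + C i) (inter δ₁ δ₂ Ω P) := by
    intro m n
    rw [mixedSoliton_eq]
    congr 1
    funext i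
    rw [phase_eq Ω P C hδ₂, field, hp, dispQ_zero hδ₂]
    simp only [a, k]
    ring
  refine ⟨?_, ?_⟩
  · simpa only [hF] using maxWeight_eventually_affine a k C (inter δ₁ δ₂ Ω P) hak
  -- The behaviour at +∞ is that at −∞ after n ↦ −n, which negates the slopes k.
  · obtain ⟨α, β, γ, h⟩ := maxWeight_eventually_affine a (fun i => -k i) C (inter δ₁ δ₂ Ω P)
      fun i hi => hak i (neg_eq_zero.mp hi)
    refine ⟨α, -β, γ, fun m => ?_⟩
    filter_upwards [tendsto_neg_atTop_atBot.eventually (h m)] with n hn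
    rw [hF]
    push_cast at hn
    simp only [neg_mul_neg] at hn
    rw [hn]
    ring

theorem boxBall_mixedSoliton (hδ₁ : 0 < δ₁) (hδ₂ : δ₁ < δ₂) (F U V X : ℤ → ℤ → ℝ)
    (hF : F = mixedSoliton δ₁ δ₂ Ω P C) (hU : U = fieldU F) (hV : V = fieldV F)
    (hX : X = fieldX F) :
    (∀ m n : ℤ, -δ₂ + X m n + X m (n + 1) < 0) ∧
      (∀ m : ℤ, Tendsto (U m) atBot (nhds 0) ∧ Tendsto (V m) atBot (nhds 0) ∧
        Tendsto (X m) atBot (nhds 0)) ∧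
      (∀ m n : ℤ, V m n = carrierLoad (U (m - 1)) (U m) n) ∧ IsBoxBallEvolution δ₁ U := by
  have hineq := kdv_inequalities Ω P C hδ₁ hδ₂
  obtain ⟨⟨α, β, γ, hbot⟩, ⟨α', β', γ', htop⟩⟩ :=
    mixedSoliton_eventually_affine Ω P C hδ₁ (hδ₁.trans hδ₂)
  have hsol := solvesEBB_mixedSoliton Ω P C hδ₁ hδ₂
  rw [← hF] at hineq hbot htop hsol
  clear hF
  have hU' : ∀ m n, U m n = F m (n + 1) + F (m + 1) n - F m n - F (m + 1) (n + 1) := fun m n => by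
    rw [hU, fieldU]
  have hV' : ∀ m n, V m n = F (m + 1) n + F (m - 1) n - 2 * F m n := fun m n => by
    rw [hV, fieldV]
  have hX' : ∀ m n, X m n = F m (n + 1) + F m (n - 1) - 2 * F m n := fun m n => by
    rw [hX, fieldX]
  have hshift : ∀ j : ℤ, Tendsto (fun n : ℤ => n + j) atBot atBot := fun j =>
    tendsto_atBot_add_const_right _ j tendsto_id
  have hshift' : ∀ j : ℤ, Tendsto (fun n : ℤ => n + j) atTop atTop := fun j =>
    tendsto_atTop_add_const_right _ j tendsto_id
  have hU0 : ∀ m, ∀ᶠ n in atBot, U m n = 0 := by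
    intro m
    filter_upwards [hbot m, hbot (m + 1), (hshift 1).eventually (hbot m),
      (hshift 1).eventually (hbot (m + 1))] with n h1 h2 h3 h4
    rw [hU', h1, h2, h3, h4]
    push_cast
    ring
  have hU1 : ∀ m, ∀ᶠ n in atTop, U m n = 0 := by
    intro m
    filter_upwards [htop m, htop (m + 1), (hshift' 1).eventually (htop m),
      (hshift' 1).eventually (htop (m + 1))] with n h1 h2 h3 h4
    rw [hU', h1, h2, h3, h4]
    push_cast
    ring
  have hV0 : ∀ m, ∀ᶠ n in atBot, V m n = 0 := by
    intro m
    filter_upwards [hbot m, hbot (m + 1), hbot (m - 1)] with n h1 h2 h3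
    rw [hV', h1, h2, h3]
    push_cast
    ring
  have hX0 : ∀ m, ∀ᶠ n in atBot, X m n = 0 := by
    intro m
    filter_upwards [hbot m, (hshift 1).eventually (hbot m),
      (hshift (-1)).eventually (hbot m)] with n h1 h2 h3
    rw [← sub_eq_add_neg] at h3
    rw [hX', h1, h2, h3]
    push_cast
    ring
  have hload : ∀ m n : ℤ, V m n = carrierLoad (U (m - 1)) (U m) n := by
    intro m n
    refine (carrierLoad_eq (fun k => ?_) (hV0 m) n).symm
    simp only [hU', hV', sub_add_cancel]
    ring
  refine ⟨fun m n => ?_, fun m => ⟨?_, ?_, ?_⟩, hload, ⟨fun m => ⟨?_, ?_, ?_⟩, fun m n => ?_⟩⟩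
  · have h1 := (hineq m n).1
    have e1 : n + 1 + 1 = n + 2 := by ring
    have e2 : n + 1 - 1 = n := by ring
    rw [hX', hX', e1, e2]
    linarith
  · exact tendsto_const_nhds.congr' ((hU0 m).mono fun n h => h.symm)
  · exact tendsto_const_nhds.congr' ((hV0 m).mono fun n h => h.symm)
  · exact tendsto_const_nhds.congr' ((hX0 m).mono fun n h => h.symm)
  · intro n
    have := (hineq m n).2.1
    rw [hU']
    linarith
  · intro n
    have := (hineq m n).2.2
    rw [hU']
    linarith
  · have : ∀ᶠ n in cofinite, U m n = 0 := by
      rw [Int.cofinite_eq]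
      exact eventually_sup.mpr ⟨hU0 m, hU1 m⟩
    exact eventually_cofinite.mp this
  · rw [← hload]
    have h1 := hsol m n
    have h2 := (hineq m n).1
    -- As δ₁ < δ₂, the third entry of the maximum never exceeds the first. Solving the remaining
    -- two-term equation for U turns the maximum into the minimum of V and δ₁ − U^{m−1}.
    have h3 : F m (n + 2) + F m (n - 1) - δ₂ ≤ F m (n + 1) + F m n := by linarith
    simp only [hU', hV', sub_add_cancel]
    grind

end BoxBall

end MixedSoliton

end

theorem mainTheorem3 (δ₁ δ₂ : ℝ) (hδ₁ : 0 < δ₁) (hδ₂ : δ₁ < δ₂) (N M : ℕ)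
    (Ω : Fin N → ℝ) (P : Fin M → ℝ) (C : Fin (N + M) → ℝ)
    (F U V X : ℤ → ℤ → ℝ)
    (hF : F = MixedSoliton.mixedSoliton δ₁ δ₂ Ω P C)
    (hU : U = MixedSoliton.fieldU F)
    (hV : V = MixedSoliton.fieldV F)
    (hX : X = MixedSoliton.fieldX F) :
    MixedSoliton.SolvesEBB δ₁ δ₂ F ∧
    (M = 0 →
      (∀ m n : ℤ, -δ₂ + X m n + X m (n + 1) < 0) ∧
      (∀ m : ℤ, Filter.Tendsto (U m) Filter.atBot (nhds 0) ∧
        Filter.Tendsto (V m) Filter.atBot (nhds 0) ∧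
        Filter.Tendsto (X m) Filter.atBot (nhds 0)) ∧
      (∀ m n : ℤ, V m n = MixedSoliton.carrierLoad (U (m - 1)) (U m) n) ∧
      MixedSoliton.IsBoxBallEvolution δ₁ U) := by
  refine ⟨hF ▸ MixedSoliton.solvesEBB_mixedSoliton Ω P C hδ₁ hδ₂, ?_⟩
  rintro rfl
  exact MixedSoliton.boxBall_mixedSoliton Ω P C hδ₁ hδ₂ F U V X hF hU hV hX
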